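/- Let $q$ be a complex number with $0<|q|<1$ and put $(x;q)_\infty=\prod_{n\ge 0}(1-xq^n)$, $(x;q)_n=\prod_{k=0}^{n-1}(1-xq^k)$ and $(x;q)_{-n}=\prod_{k=1}^{n}(1-xq^{-k})^{-1}$ for $n\ge 0$, and $(x_1,\dots,x_m;q)_n=(x_1;q)_n\cdots(x_m;q)_n$. The very-well-poised series are $${}_8W_7[a_1;a_4,\dots,a_8;q,x]=\sum_{n=0}^{\infty}\frac{(a_1,q\sqrt{a_1},-q\sqrt{a_1},a_4,\dots,a_8;q)_n}{(q,\sqrt{a_1},-\sqrt{a_1},a_1q/a_4,\dots,a_1q/a_8;q)_n}\,x^n,$$ $${}_8\psi_8[a;a_3,\dots,a_8;q,x]=\sum_{n=-\infty}^{\infty}\frac{(q\sqrt a,-q\sqrt a,a_3,\dots,a_8;q)_n}{(\sqrt a,-\sqrt a,aq/a_3,\dots,aq/a_8;q)_n}\,x^n,$$ with the principal square root. Proposition. Let $c,d,e$ be nonzero complex numbers and $z=cde/q$, with $|q/z|<1$. Assume that none of $c,d,e,1/z$ is of the form $q^{j}$ with an integer $j\ge 1$, and that $z^2\ne q$. Then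 the series ${}_8W_7[1/z;c/z,d/z,e/z,1/z,z;q,q]$ converges absolutely, the series ${}_8\psi_8[a;\sqrt a,c,d,e,1/z,z;q,q/z]$ converges absolutely for all $a\ne 1$ sufficiently close to $1$, its limit as $a\to 1$ (through complex $a\neq 1$) exists, and $${}_8W_7[1/z;c/z,d/z,e/z,1/z,z;q,q]=\frac{(zq;q)_\infty}{(q/z^2;q)_\infty}\,\frac{(q/z;q)_\infty^3}{(q;q)_\infty^3}\,\lim_{a\to1}{}_8\psi_8[a;\sqrt a,c,d,e,1/z,z;q,q/z].$$ (For $z=1$ the terms with $n\ge1$ of the ${}_8W_7$ series, whose numerators contain the factor $(1;q)_n^3$, are read as $0$.) -/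

import Mathlib

open Filter Topology

noncomputable section

/-- The infinite `q`-shifted factorial `(x; q)_∞ = ∏_{n ≥ 0} (1 - x q ^ n)`. -/
def qPochInf (x q : ℂ) : ℂ := ∏' n : ℕ, (1 - x * q ^ n)

/-- The `q`-shifted factorial `(x; q)_n` of integer order `n`:
`(x; q)_n = (1 - x) (1 - x q) ⋯ (1 - x q ^ (n - 1))` for `n ≥ 0` and
`(x; q)_{-m} = 1 / ((1 - x q ^ (-1)) ⋯ (1 - x q ^ (-m)))` for `m ≥ 1`.
It is the quotient `(x; q)_∞ / (x q ^ n; q)_∞`, see `qPoch_eq_div`; the finite product keeps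
its meaning where this quotient reads `0 / 0`. -/
def qPoch (x q : ℂ) : ℤ → ℂ
  | Int.ofNat n => ∏ k ∈ Finset.range n, (1 - x * q ^ k)
  | Int.negSucc m => (∏ k ∈ Finset.range (m + 1), (1 - x * (q ^ (k + 1))⁻¹))⁻¹

theorem multipliable_qPochInf (x : ℂ) {q : ℂ} (hq : ‖q‖ < 1) :
    Multipliable fun n : ℕ => 1 - x * q ^ n := by
  have h : Summable fun n : ℕ => ‖-(x * q ^ n)‖ := by
    simp only [norm_neg, norm_mul, norm_pow]
    exact (summable_geometric_of_lt_one (norm_nonneg q) hq).mul_left _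
  simpa [sub_eq_add_neg] using multipliable_one_add_of_summable h

theorem qPochInf_split (x : ℂ) {q : ℂ} (hq : ‖q‖ < 1) (n : ℕ) :
    (∏ k ∈ Finset.range n, (1 - x * q ^ k)) * qPochInf (x * q ^ n) q = qPochInf x q := by
  induction n with
  | zero => simp
  | succ n ih =>
    rw [← ih, Finset.prod_range_succ, mul_assoc]
    congr 1
    have h := (multipliable_qPochInf (x * q ^ (n + 1)) hq)
    have h2 : Multipliable fun k : ℕ => (1 - x * q ^ n * q ^ (k + 1)) := by
      refine h.congr fun k => ?_
      ring
    have h3 := tprod_eq_zero_mul' (f := fun k : ℕ => 1 - x * q ^ n * q ^ k) h2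
    unfold qPochInf
    rw [h3, pow_zero, mul_one]
    congr 1
    refine tprod_congr fun k => ?_
    ring

/-- The defining quotient of the `q`-shifted factorial. -/
theorem qPoch_eq_div (x : ℂ) {q : ℂ} (hq0 : q ≠ 0) (hq : ‖q‖ < 1) (n : ℤ)
    (h : qPochInf (x * q ^ n) q ≠ 0) :
    qPoch x q n = qPochInf x q / qPochInf (x * q ^ n) q := by
  rw [eq_div_iff h]
  cases n with
  | ofNat n => simpa [qPoch] using qPochInf_split x hq n
  | negSucc m =>
    have hs := qPochInf_split (x * q ^ (Int.negSucc m)) hq (m + 1)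
    have hx : x * q ^ (Int.negSucc m) * q ^ (m + 1) = x := by
      rw [zpow_negSucc, mul_assoc, inv_mul_cancel₀ (pow_ne_zero _ hq0), mul_one]
    rw [hx] at hs
    have hp : (∏ k ∈ Finset.range (m + 1), (1 - x * (q ^ (k + 1))⁻¹)) =
        ∏ k ∈ Finset.range (m + 1), (1 - x * q ^ (Int.negSucc m) * q ^ k) := by
      rw [← Finset.prod_range_reflect]
      refine Finset.prod_congr rfl fun k hk => ?_
      have hk' : k < m + 1 := Finset.mem_range.mp hk
      have e : m + 1 = (m + 1 - 1 - k + 1) + k := by omega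
      rw [zpow_negSucc]
      congr 1
      rw [mul_assoc]
      congr 1
      conv_rhs => rw [e, pow_add]
      field_simp
    have hne : (∏ k ∈ Finset.range (m + 1), (1 - x * (q ^ (k + 1))⁻¹)) ≠ 0 := by
      intro h0
      rw [hp] at h0
      rw [h0, zero_mul] at hs
      exact h hs.symm
    show (∏ k ∈ Finset.range (m + 1), (1 - x * (q ^ (k + 1))⁻¹))⁻¹ * _ = _
    rw [inv_mul_eq_iff_eq_mul₀ hne, hp, hs]

/-- The multi-parameter factorial `(x₁, …, x_m; q)_n = (x₁; q)_n ⋯ (x_m; q)_n`. -/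
def qPochList (l : List ℂ) (q : ℂ) (n : ℤ) : ℂ := (l.map fun x => qPoch x q n).prod

/-- The `n`-th term of the basic hypergeometric series with upper parameters `as`, lower
parameters `bs`, base `q` and argument `z`. -/
def phiTerm (as bs : List ℂ) (q z : ℂ) (n : ℕ) : ℂ :=
  qPochList as q n / qPochList bs q n * (z ^ n / qPoch q q n)

/-- The `n`-th term of the bilateral basic hypergeometric series with upper parameters `as`,
lower parameters `bs`, base `q` and argument `z`. -/
def psiTerm (as bs : List ℂ) (q z : ℂ) (n : ℤ) : ℂ :=
  qPochList as q n / qPochList bs q n * z ^ n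

/-- The `n`-th term of the very-well-poised series `_{r+1}W_r[a₁; l; q, z]`: the upper parameters
are `a₁, q √a₁, -q √a₁` followed by `l`, and every upper parameter other than `a₁` has a lower
partner with which its product is `a₁ q`. -/
def vwpWTerm (a₁ : ℂ) (l : List ℂ) (q z : ℂ) (n : ℕ) : ℂ :=
  phiTerm (a₁ :: (q * Complex.sqrt a₁) :: (-(q * Complex.sqrt a₁)) :: l)
    (Complex.sqrt a₁ :: (-Complex.sqrt a₁) :: l.map fun x => a₁ * q / x) q z n

/-- The very-well-poised series `_{r+1}W_r[a₁; l; q, z]`, where `l` lists `a₄, …, a_{r+1}`. -/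
def vwpW (a₁ : ℂ) (l : List ℂ) (q z : ℂ) : ℂ := ∑' n : ℕ, vwpWTerm a₁ l q z n

/-- The `n`-th term of the very-well-poised bilateral series `_rψ_r[a; l; q, z]`: the upper
parameters are `q √a, -q √a` followed by `l`, and every upper parameter has a lower partner with
which its product is `a q`. -/
def vwpPsiTerm (a : ℂ) (l : List ℂ) (q z : ℂ) (n : ℤ) : ℂ :=
  psiTerm ((q * Complex.sqrt a) :: (-(q * Complex.sqrt a)) :: l)
    (Complex.sqrt a :: (-Complex.sqrt a) :: l.map fun x => a * q / x) q z n

/-- The very-well-poised bilateral series `_rψ_r[a; l; q, z]`, where `l` lists `a₃, …, a_r`. -/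
def vwpPsi (a : ℂ) (l : List ℂ) (q z : ℂ) : ℂ := ∑' n : ℤ, vwpPsiTerm a l q z n

end

/-! The identity comes from summing one double series, `doubleTerm`, in two ways. Its entry at `(k,
m)` is a factor depending only on `n = k + m` times the `k`-th term of a terminating
very-well-poised `₈φ₇` of order `n`.

On the antidiagonal `k + m = n`, Jackson's sum (`jackson_sum`) gives the quotient of `(c, d, e;
q)_n` by `(q/c, q/d, q/e; q)_n`, so the total is `∑ foldTerm`. On the row of fixed `k`, the series
in `m` is a very-well-poised `₆φ₅` with `a = q^(2k)`, and its sum (`tsum_sixTerm`) is a constant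
times the `k`-th term of the `₈W₇`. Absolute convergence makes the two totals equal
(`hasSum_foldTerm`).

For the bilateral side put `s = √a`. For `s ≠ 1` near `1`, the parameter `√a` cancels most of the
very-well-poised part, leaving terms that are continuous at `s = 1` and geometrically dominated. At
`s = 1` the terms of index `n` and `-n` agree and add up to `foldTerm n`, so dominated convergence
identifies the limit (`vwpPsi_summable_and_tendsto`).

Both classical sums are proved from scratch: Jackson's by a telescoping certificate, the `₆φ₅` by
iterating the shift `(a, x) → (aq, xq)`. -/

noncomputable section

/-! ### Finite `q`-shifted factorials and the contiguous relation for partial `₆φ₅` sums. -/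

/-- The finite `q`-shifted factorial of natural order. -/
def qFac (x q : ℂ) (n : ℕ) : ℂ := ∏ k ∈ Finset.range n, (1 - x * q ^ k)

@[simp] theorem qFac_zero (x q : ℂ) : qFac x q 0 = 1 := by simp [qFac]

theorem qFac_succ (x q : ℂ) (n : ℕ) : qFac x q (n + 1) = qFac x q n * (1 - x * q ^ n) := by
  simp [qFac, Finset.prod_range_succ]

theorem qFac_add (x q : ℂ) (m n : ℕ) :
    qFac x q (m + n) = qFac x q m * qFac (x * q ^ m) q n := by
  simp only [qFac, Finset.prod_range_add, pow_add, mul_assoc]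

theorem qFac_succ' (x q : ℂ) (n : ℕ) : qFac x q (n + 1) = (1 - x) * qFac (x * q) q n := by
  rw [add_comm, qFac_add]; simp [qFac]

theorem qFac_ne_zero {x q : ℂ} (h : ∀ k : ℕ, x * q ^ k ≠ 1) (n : ℕ) : qFac x q n ≠ 0 :=
  Finset.prod_ne_zero_iff.mpr fun k _ => sub_ne_zero.mpr (h k).symm

/-- The factor `(1 - a q ^ (2n)) / (1 - a) * (a; q)_n` of a very-well-poised series, in a form
that keeps its meaning at `a = 1`. -/
def vwpFac (a q : ℂ) : ℕ → ℂ
  | 0 => 1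
  | n + 1 => (1 - a * q ^ (2 * (n + 1))) * qFac (a * q) q n

/-- The terms of the very-well-poised series `₆φ₅`. -/
def sixTerm (a b c d q x : ℂ) (m : ℕ) : ℂ :=
  vwpFac a q m * (qFac b q m * qFac c q m * qFac d q m) /
    (qFac q q m * (qFac (a * q / b) q m * qFac (a * q / c) q m * qFac (a * q / d) q m)) * x ^ m

/-- The balance `aq = bcdx` survives `(a, x) → (aq, xq)` with `b, c, d` fixed, so the relation can
be iterated. The boundary term carries `x ^ (M + 1)` and vanishes in the limit when `‖x‖ < 1`.
Induction on `M` leaves a rational identity. -/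
theorem sixTerm_telescope {a b c d q x : ℂ} (hb : b ≠ 0) (hc : c ≠ 0) (hd : d ≠ 0)
    (hx : a * q = b * c * d * x) (hx1 : x ≠ 1) (hq : ∀ k : ℕ, q * q ^ k ≠ 1)
    (haq : a * q ≠ 1)
    (hab : ∀ k : ℕ, a * q / b * q ^ k ≠ 1) (hac : ∀ k : ℕ, a * q / c * q ^ k ≠ 1)
    (had : ∀ k : ℕ, a * q / d * q ^ k ≠ 1) (M : ℕ) :
    ∑ m ∈ Finset.range (M + 1), sixTerm a b c d q x m =
      (1 - a * q) * (1 - d * x) * (1 - c * x) * (1 - b * x) /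
        ((1 - a * q / b) * (1 - a * q / c) * (1 - a * q / d) * (1 - x)) *
        ∑ m ∈ Finset.range (M + 1), sixTerm (a * q) b c d q (x * q) m -
      qFac (a * q) q M * (qFac b q (M + 1) * qFac c q (M + 1) * qFac d q (M + 1)) *
        x ^ (M + 1) * (1 - a * x * q ^ (M + 1)) /
        (qFac q q M * (qFac (a * q / b) q (M + 1) * qFac (a * q / c) q (M + 1) *
          qFac (a * q / d) q (M + 1)) * (1 - x)) := by
  have hx1' : 1 - x ≠ 0 := sub_ne_zero.mpr hx1.symm
  have e1 : a * q / b = c * d * x := by rw [hx]; field_simp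
  have e2 : a * q / c = b * d * x := by rw [hx]; field_simp
  have e3 : a * q / d = b * c * x := by rw [hx]; field_simp
  have e1' : a * q * q / b = c * d * x * q := by rw [hx]; field_simp
  have e2' : a * q * q / c = b * d * x * q := by rw [hx]; field_simp
  have e3' : a * q * q / d = b * c * x * q := by rw [hx]; field_simp
  rw [e1] at hab; rw [e2] at hac; rw [e3] at had
  have k1 : ∀ k : ℕ, 1 - c * d * x * q ^ k ≠ 0 := fun k => sub_ne_zero.mpr (hab k).symm
  have k2 : ∀ k : ℕ, 1 - b * d * x * q ^ k ≠ 0 := fun k => sub_ne_zero.mpr (hac k).symm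
  have k3 : ∀ k : ℕ, 1 - b * c * x * q ^ k ≠ 0 := fun k => sub_ne_zero.mpr (had k).symm
  have k10 := k1 0
  have k20 := k2 0
  have k30 := k3 0
  have h0 : 1 - a * q ≠ 0 := sub_ne_zero.mpr haq.symm
  simp only [pow_zero, mul_one] at k10 k20 k30
  have a1 : ∀ n, a * q ^ (2 * (n + 1)) = b * c * d * x * q * (q ^ n) ^ 2 := fun n => by
    rw [← hx]; ring
  have a2 : ∀ n, a * q * q ^ (2 * (n + 1)) = b * c * d * x * (q * q ^ n) ^ 2 := fun n => by
    rw [← hx]; ring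
  have a3 : ∀ n, a * x * q ^ (n + 1) = b * c * d * x * x * q ^ n := fun n => by
    rw [← hx]; ring
  rw [hx] at h0
  induction M with
  | zero =>
    simp only [zero_add, Finset.sum_range_one, sixTerm, vwpFac, qFac_zero, qFac_succ, pow_zero,
      pow_one, e1, e2, e3, mul_one, one_mul, div_one]
    have a4 := a3 0
    simp only [zero_add, pow_one, pow_zero, mul_one] at a4
    rw [a4, hx]
    clear e1 e2 e3 e1' e2' e3' hab hac had k1 k2 k3 hx1 hx haq a1 a2 a3 hq a4
    -- Denominators stay atomic while fractions are cleared, and are expanded only in the resulting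
    -- polynomial identity.
    obtain ⟨D1, hD1⟩ : ∃ D : ℂ, D = 1 - c * d * x := ⟨_, rfl⟩
    obtain ⟨D2, hD2⟩ : ∃ D : ℂ, D = 1 - b * d * x := ⟨_, rfl⟩
    obtain ⟨D3, hD3⟩ : ∃ D : ℂ, D = 1 - b * c * x := ⟨_, rfl⟩
    obtain ⟨D4, hD4⟩ : ∃ D : ℂ, D = 1 - x := ⟨_, rfl⟩
    obtain ⟨D9, hD9⟩ : ∃ D : ℂ, D = 1 - b * c * d * x := ⟨_, rfl⟩
    rw [← hD9] at h0 ⊢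
    rw [← hD1] at k10 ⊢
    rw [← hD2] at k20 ⊢
    rw [← hD3] at k30 ⊢
    rw [← hD4] at hx1' ⊢
    field_simp
    subst hD1 hD2 hD3 hD4 hD9
    ring
  | succ M ih =>
    rw [Finset.sum_range_succ, ih, Finset.sum_range_succ _ (M + 1)]
    generalize ∑ m ∈ Finset.range (M + 1), sixTerm (a * q) b c d q (x * q) m = s
    have f1 : ∀ n, qFac (c * d * x * q) q n =
      qFac (c * d * x) q n * (1 - c * d * x * q ^ n) / (1 - c * d * x) := fun n => by
        rw [eq_div_iff k10, ← qFac_succ, qFac_succ', mul_comm]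
    have f2 : ∀ n, qFac (b * d * x * q) q n =
      qFac (b * d * x) q n * (1 - b * d * x * q ^ n) / (1 - b * d * x) := fun n => by
        rw [eq_div_iff k20, ← qFac_succ, qFac_succ', mul_comm]
    have f3 : ∀ n, qFac (b * c * x * q) q n =
      qFac (b * c * x) q n * (1 - b * c * x * q ^ n) / (1 - b * c * x) := fun n => by
        rw [eq_div_iff k30, ← qFac_succ, qFac_succ', mul_comm]
    have f4 : qFac (a * q * q) q M =
      qFac (a * q) q M * (1 - a * q * q ^ M) / (1 - a * q) := by
        rw [eq_div_iff (hx ▸ h0), ← qFac_succ, qFac_succ', mul_comm]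
    simp only [sixTerm, vwpFac, a1, a2, a3, e1, e2, e3, e1', e2', e3', f1, f2, f3, f4,
      qFac_succ _ _ (M + 1), qFac_succ q q M, qFac_succ (a * q) q M]
    have g1 := qFac_ne_zero hab (M + 1)
    have g2 := qFac_ne_zero hac (M + 1)
    have g3 := qFac_ne_zero had (M + 1)
    have g4 := qFac_ne_zero hq M
    have g5 := sub_ne_zero.mpr (hq M).symm
    have l1 := k1 (M + 1)
    have l2 := k2 (M + 1)
    have l3 := k3 (M + 1)
    rw [hx]
    generalize qFac (c * d * x) q (M + 1) = y1 at *
    generalize qFac (b * d * x) q (M + 1) = y2 at *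
    generalize qFac (b * c * x) q (M + 1) = y3 at *
    generalize qFac b q (M + 1) = y5 at *
    generalize qFac c q (M + 1) = y6 at *
    generalize qFac d q (M + 1) = y7 at *
    generalize qFac q q M = y4 at *
    generalize qFac (b * c * d * x) q M = y8 at *
    have p1 : (x * q) ^ (M + 1) = x ^ (M + 1) * (q * q ^ M) := by ring
    have p2 : x ^ (M + 1 + 1) = x ^ (M + 1) * x := by ring
    rw [p1, p2]
    rw [pow_succ' q M] at l1 l2 l3 ⊢
    clear ih a1 a2 a3 f1 f2 f3 f4 k1 k2 k3 e1 e2 e3 e1' e2' e3' hab hac had hq hx haq p1 p2 hx1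
    generalize x ^ (M + 1) = X at *
    generalize q ^ M = P at *
    rw [← sub_eq_zero]
    obtain ⟨D1, hD1⟩ : ∃ D : ℂ, D = 1 - c * d * x := ⟨_, rfl⟩
    obtain ⟨D2, hD2⟩ : ∃ D : ℂ, D = 1 - b * d * x := ⟨_, rfl⟩
    obtain ⟨D3, hD3⟩ : ∃ D : ℂ, D = 1 - b * c * x := ⟨_, rfl⟩
    obtain ⟨D4, hD4⟩ : ∃ D : ℂ, D = 1 - x := ⟨_, rfl⟩
    obtain ⟨D5, hD5⟩ : ∃ D : ℂ, D = 1 - c * d * x * (q * P) := ⟨_, rfl⟩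
    obtain ⟨D6, hD6⟩ : ∃ D : ℂ, D = 1 - b * d * x * (q * P) := ⟨_, rfl⟩
    obtain ⟨D7, hD7⟩ : ∃ D : ℂ, D = 1 - b * c * x * (q * P) := ⟨_, rfl⟩
    obtain ⟨D8, hD8⟩ : ∃ D : ℂ, D = 1 - q * P := ⟨_, rfl⟩
    obtain ⟨D9, hD9⟩ : ∃ D : ℂ, D = 1 - b * c * d * x := ⟨_, rfl⟩
    rw [← hD9] at h0 ⊢
    rw [← hD1] at k10 ⊢
    rw [← hD2] at k20 ⊢
    rw [← hD3] at k30 ⊢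
    rw [← hD4] at hx1' ⊢
    rw [← hD5] at l1 ⊢
    rw [← hD6] at l2 ⊢
    rw [← hD7] at l3 ⊢
    rw [← hD8] at g5 ⊢
    field_simp
    subst hD1 hD2 hD3 hD4 hD5 hD6 hD7 hD8 hD9
    ring

/-! ### Jackson's terminating `₈φ₇` sum by a telescoping certificate. -/

/-- The terms of Jackson's terminating very-well-poised `₈φ₇` sum of order `k + m`. -/
def jacksonTerm (c d e z q : ℂ) (k m : ℕ) : ℂ :=
  vwpFac (1 / z) q k * (qFac (c / z) q k * qFac (d / z) q k * qFac (e / z) q k) /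
    (qFac q q k * (qFac (q / c) q k * qFac (q / d) q k * qFac (q / e) q k)) * z ^ k *
    (qFac q q (k + m) * qFac z q m * qFac (q ^ (k + m)) q k /
      (qFac q q m * qFac (q / z) q (k + m + k)))

/-- The telescoped difference of two consecutive Jackson sums. -/
def jacksonCert (c d e z q : ℂ) (k m : ℕ) : ℂ :=
  qFac (q / z) q k * (qFac (c / z) q (k + 1) * qFac (d / z) q (k + 1) * qFac (e / z) q (k + 1)) /
    (qFac q q k * (qFac (q / c) q k * qFac (q / d) q k * qFac (q / e) q k)) * z ^ (k + 1) *
    (qFac q q (k + m) * qFac z q m * qFac (q ^ (k + m + 1)) q k /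
      (qFac q q m * qFac (q / z) q (k + m + k + 1))) *
    (q ^ m * (1 - q * q ^ (k + m) * q ^ (k + m)) /
      ((1 - q / c * q ^ (k + m)) * (1 - q / d * q ^ (k + m)) * (1 - q / e * q ^ (k + m))))

/-- The quotient of two consecutive Jackson sums. -/
def jacksonRatio (c d e q : ℂ) (n : ℕ) : ℂ :=
  (1 - c * q ^ n) * (1 - d * q ^ n) * (1 - e * q ^ n) /
    ((1 - q / c * q ^ n) * (1 - q / d * q ^ n) * (1 - q / e * q ^ n))

section
variable {c d e z q : ℂ} (hc0 : c ≠ 0) (hd0 : d ≠ 0) (he0 : e ≠ 0) (hz0 : z ≠ 0) (hq0 : q ≠ 0)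
  (hz : c * d * e = z * q) (hq : ∀ k : ℕ, q * q ^ k ≠ 1)
  (hc : ∀ k : ℕ, q / c * q ^ k ≠ 1) (hd : ∀ k : ℕ, q / d * q ^ k ≠ 1)
  (he : ∀ k : ℕ, q / e * q ^ k ≠ 1) (hqz : ∀ k : ℕ, q / z * q ^ k ≠ 1)
include hc0 hd0 he0 hz0 hq0 hz hq hc hd he hqz

/-- The end `k = 0` of the telescoping, where no earlier certificate occurs. -/
theorem jacksonTerm_zero (m : ℕ) :
    jacksonTerm c d e z q 0 (m + 1) - jacksonRatio c d e q m * jacksonTerm c d e z q 0 m =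
      -jacksonCert c d e z q 0 m := by
  have hz' : z = c * d * e / q := by rw [hz]; field_simp
  simp only [jacksonTerm, jacksonCert, jacksonRatio, vwpFac, qFac_zero, zero_add, qFac_succ,
    pow_zero, pow_one, add_zero, mul_one, one_mul, div_one]
  have g1 := qFac_ne_zero hq m
  have g2 := sub_ne_zero.mpr (hq m).symm
  have g3 := qFac_ne_zero hqz m
  have g4 := sub_ne_zero.mpr (hqz m).symm
  have g5 := sub_ne_zero.mpr (hc m).symm
  have g6 := sub_ne_zero.mpr (hd m).symm
  have g7 := sub_ne_zero.mpr (he m).symm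
  generalize qFac q q m = y1 at *
  generalize qFac (q / z) q m = y2 at *
  generalize qFac z q m = y3 at *
  clear hq hc hd he hqz
  generalize q ^ m = P at *
  obtain ⟨D1, hD1⟩ : ∃ D : ℂ, D = 1 - q * P := ⟨_, rfl⟩
  obtain ⟨D2, hD2⟩ : ∃ D : ℂ, D = 1 - q / z * P := ⟨_, rfl⟩
  obtain ⟨D3, hD3⟩ : ∃ D : ℂ, D = 1 - q / c * P := ⟨_, rfl⟩
  obtain ⟨D4, hD4⟩ : ∃ D : ℂ, D = 1 - q / d * P := ⟨_, rfl⟩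
  obtain ⟨D5, hD5⟩ : ∃ D : ℂ, D = 1 - q / e * P := ⟨_, rfl⟩
  rw [← hD1] at g2 ⊢
  rw [← hD2] at g4 ⊢
  rw [← hD3] at g5 ⊢
  rw [← hD4] at g6 ⊢
  rw [← hD5] at g7 ⊢
  rw [← sub_eq_zero]
  field_simp
  rw [hD2, hD3, hD4, hD5]
  clear hD1 hD2 hD3 hD4 hD5 g1 g2 g3 g4 g5 g6 g7
  subst hz'
  field_simp
  ring

/-- A `q`-analogue of a Wilf–Zeilberger pair in the variables `k` and `n = k + m`: the left side
raises the order with the summation index fixed, the right side is a difference in the index at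
fixed order. -/
theorem jacksonTerm_succ (k m : ℕ) :
    jacksonTerm c d e z q (k + 1) (m + 1) -
      jacksonRatio c d e q (k + 1 + m) * jacksonTerm c d e z q (k + 1) m =
      jacksonCert c d e z q k (m + 1) - jacksonCert c d e z q (k + 1) m := by
  have hz' : z = c * d * e / q := by rw [hz]; field_simp
  have r1 : k + 1 + (m + 1) = k + 1 + m + 1 := by ring
  have r2 : k + (m + 1) = k + 1 + m := by ring
  have r3 : k + 1 + m + 1 + (k + 1) = k + 1 + m + k + 1 + 1 := by ring
  have r4 : k + 1 + m + (k + 1) = k + 1 + m + k + 1 := by ring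
  have s1 : qFac (q ^ (k + 1 + m)) q (k + 1) =
      (1 - q ^ (k + 1 + m)) * qFac (q ^ (k + 1 + m + 1)) q k := by
    rw [qFac_succ', pow_succ q (k + 1 + m)]
  have s2 : 1 / z * q ^ (2 * (k + 1)) = q / z * (q * q ^ k * q ^ k) := by ring
  simp only [jacksonTerm, jacksonCert, jacksonRatio, vwpFac, r1, r2, r3, r4, s1, s2,
    qFac_succ _ _ (k + 1 + m + k + 1), qFac_succ _ _ (k + 1 + m), qFac_succ _ _ m,
    qFac_succ _ _ k, qFac_succ _ _ (k + 1), one_div_mul_eq_div]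
  have g1 := qFac_ne_zero hq m
  have g2 := sub_ne_zero.mpr (hq m).symm
  have g3 := qFac_ne_zero hqz (k + 1 + m + k + 1)
  have g4 := sub_ne_zero.mpr (hqz (k + 1 + m + k + 1)).symm
  have g5 := sub_ne_zero.mpr (hc (k + 1 + m)).symm
  have g6 := sub_ne_zero.mpr (hd (k + 1 + m)).symm
  have g7 := sub_ne_zero.mpr (he (k + 1 + m)).symm
  have g8 := sub_ne_zero.mpr (hc k).symm
  have g9 := sub_ne_zero.mpr (hd k).symm
  have g10 := sub_ne_zero.mpr (he k).symm
  have g11 := sub_ne_zero.mpr (hq k).symm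
  have g12 := qFac_ne_zero hq k
  have g13 := qFac_ne_zero hc k
  have g14 := qFac_ne_zero hd k
  have g15 := qFac_ne_zero he k
  clear hq hc hd he hqz r1 r2 r3 r4 s1 s2
  generalize qFac q q m = y1 at *
  generalize qFac (q / z) q (k + 1 + m + k + 1) = y2 at *
  generalize qFac (q / z) q k = y3 at *
  generalize qFac q q k = y4 at *
  generalize qFac (q / c) q k = y5 at *
  generalize qFac (q / d) q k = y6 at *
  generalize qFac (q / e) q k = y7 at *
  generalize qFac (c / z) q k = y8 at *
  generalize qFac (d / z) q k = y9 at *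
  generalize qFac (e / z) q k = y10 at *
  generalize qFac z q m = y11 at *
  generalize qFac q q (k + 1 + m) = y12 at *
  generalize qFac (q ^ (k + 1 + m + 1)) q k = y13 at *
  have t1 : q ^ (k + 1 + m + k + 1) = q * q * q ^ k * q ^ k * q ^ m := by ring
  have t2 : q ^ (k + 1 + m + 1) = q * q * q ^ k * q ^ m := by ring
  have t3 : q ^ (k + 1 + m) = q * q ^ k * q ^ m := by ring
  simp only [t1, t2, t3, pow_succ z, pow_succ q m, pow_succ q k] at *
  clear t1 t2 t3
  generalize q ^ m = P at *
  generalize q ^ k = Q at *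
  generalize z ^ k = Z at *
  obtain ⟨D1, hD1⟩ : ∃ D : ℂ, D = 1 - q * P := ⟨_, rfl⟩
  obtain ⟨D2, hD2⟩ : ∃ D : ℂ, D = 1 - q / z * (q * q * Q * Q * P) := ⟨_, rfl⟩
  obtain ⟨D3, hD3⟩ : ∃ D : ℂ, D = 1 - q / c * (q * Q * P) := ⟨_, rfl⟩
  obtain ⟨D4, hD4⟩ : ∃ D : ℂ, D = 1 - q / d * (q * Q * P) := ⟨_, rfl⟩
  obtain ⟨D5, hD5⟩ : ∃ D : ℂ, D = 1 - q / e * (q * Q * P) := ⟨_, rfl⟩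
  obtain ⟨D6, hD6⟩ : ∃ D : ℂ, D = 1 - q / c * Q := ⟨_, rfl⟩
  obtain ⟨D7, hD7⟩ : ∃ D : ℂ, D = 1 - q / d * Q := ⟨_, rfl⟩
  obtain ⟨D8, hD8⟩ : ∃ D : ℂ, D = 1 - q / e * Q := ⟨_, rfl⟩
  obtain ⟨D9, hD9⟩ : ∃ D : ℂ, D = 1 - q * Q := ⟨_, rfl⟩
  rw [← hD1] at g2 ⊢
  rw [← hD2] at g4 ⊢
  rw [← hD3] at g5 ⊢
  rw [← hD4] at g6 ⊢
  rw [← hD5] at g7 ⊢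
  rw [← hD6] at g8 ⊢
  rw [← hD7] at g9 ⊢
  rw [← hD8] at g10 ⊢
  rw [← hD9] at g11 ⊢
  rw [← sub_eq_zero]
  field_simp
  rw [hD1, hD2, hD3, hD4, hD5, hD6, hD7, hD8, hD9]
  clear hD1 hD2 hD3 hD4 hD5 hD6 hD7 hD8 hD9 g1 g2 g3 g4 g5 g6 g7 g8 g9 g10 g11 g12 g13 g14 g15
  subst hz'
  field_simp
  ring

theorem jacksonTerm_sum_sub (k m : ℕ) :
    ∑ i ∈ Finset.range (k + 1), (jacksonTerm c d e z q i (k + m + 1 - i) -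
      jacksonRatio c d e q (k + m) * jacksonTerm c d e z q i (k + m - i)) =
      -jacksonCert c d e z q k m := by
  induction k generalizing m with
  | zero =>
    simpa using jacksonTerm_zero hc0 hd0 he0 hz0 hq0 hz hq hc hd he hqz m
  | succ k ih =>
    rw [Finset.sum_range_succ]
    have h := ih (m + 1)
    rw [show k + (m + 1) = k + 1 + m by ring] at h
    rw [h, show k + 1 + m + 1 - (k + 1) = m + 1 by omega, show k + 1 + m - (k + 1) = m by omega,
      jacksonTerm_succ hc0 hd0 he0 hz0 hq0 hz hq hc hd he hqz]
    ring

omit hz hc0 hd0 he0 hz0 hq0 in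
-- The sum of order `n + 1` has one more term than that of order `n`; this extra term cancels the
-- certificate left by the telescoping.
theorem jacksonTerm_last (n : ℕ) : jacksonTerm c d e z q (n + 1) 0 = jacksonCert c d e z q n 0 := by
  have s1 : qFac (q ^ (n + 1)) q (n + 1) =
      qFac (q ^ (n + 1)) q n * (1 - q * q ^ n * q ^ n) := by
    rw [qFac_succ, pow_succ' q n]
  have s2 : 1 / z * q ^ (2 * (n + 1)) = q / z * q ^ (n + n + 1) := by ring
  have r1 : n + 1 + (n + 1) = n + n + 1 + 1 := by ring
  simp only [jacksonTerm, jacksonCert, vwpFac, add_zero, qFac_zero, s1, s2, r1,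
    qFac_succ _ _ (n + n + 1), qFac_succ _ _ n, one_div_mul_eq_div]
  have g1 := qFac_ne_zero hq n
  have g2 := sub_ne_zero.mpr (hq n).symm
  have g3 := qFac_ne_zero hqz (n + n + 1)
  have g4 := sub_ne_zero.mpr (hqz (n + n + 1)).symm
  have g5 := sub_ne_zero.mpr (hc n).symm
  have g6 := sub_ne_zero.mpr (hd n).symm
  have g7 := sub_ne_zero.mpr (he n).symm
  have g13 := qFac_ne_zero hc n
  have g14 := qFac_ne_zero hd n
  have g15 := qFac_ne_zero he n
  generalize 1 - q / z * q ^ (n + n + 1) = D1 at *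
  generalize 1 - q / c * q ^ n = D2 at *
  generalize 1 - q / d * q ^ n = D3 at *
  generalize 1 - q / e * q ^ n = D4 at *
  generalize 1 - q * q ^ n = D5 at *
  generalize qFac (q ^ (n + 1)) q n = D6 at *
  generalize 1 - q * q ^ n * q ^ n = D7 at *
  generalize 1 - c / z * q ^ n = D8 at *
  field_simp

/-- Jackson's terminating `₈φ₇` sum. -/
theorem jackson_sum (n : ℕ) :
    ∑ p ∈ Finset.HasAntidiagonal.antidiagonal n, jacksonTerm c d e z q p.1 p.2 =
      qFac c q n * qFac d q n * qFac e q n /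
        (qFac (q / c) q n * qFac (q / d) q n * qFac (q / e) q n) := by
  induction n with
  | zero => simp [jacksonTerm, vwpFac]
  | succ n ih =>
    rw [Finset.Nat.sum_antidiagonal_eq_sum_range_succ (jacksonTerm c d e z q)] at ih ⊢
    have h := jacksonTerm_sum_sub hc0 hd0 he0 hz0 hq0 hz hq hc hd he hqz n 0
    rw [Finset.sum_sub_distrib, ← Finset.mul_sum, ← jacksonTerm_last hq hc hd he hqz, add_zero,
      ih] at h
    rw [Finset.sum_range_succ, Nat.sub_self, sub_eq_iff_eq_add.mp h]
    simp only [jacksonRatio, qFac_succ]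
    have g5 := sub_ne_zero.mpr (hc n).symm
    have g6 := sub_ne_zero.mpr (hd n).symm
    have g7 := sub_ne_zero.mpr (he n).symm
    have g13 := qFac_ne_zero hc n
    have g14 := qFac_ne_zero hd n
    have g15 := qFac_ne_zero he n
    generalize 1 - q / c * q ^ n = D2 at *
    generalize 1 - q / d * q ^ n = D3 at *
    generalize 1 - q / e * q ^ n = D4 at *
    field_simp
    ring

end

/-! ### Uniform bounds and limits of `q`-shifted factorials. -/

theorem geom_partial_le {r : ℝ} (h0 : 0 ≤ r) (h1 : r < 1) (n : ℕ) :
    ∑ k ∈ Finset.range n, r ^ k ≤ (1 - r)⁻¹ := by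
  rw [← tsum_geometric_of_lt_one h0 h1]
  exact (summable_geometric_of_lt_one h0 h1).sum_le_tsum _ fun _ _ => by positivity

theorem exists_norm_qFac_le {q : ℂ} (hq : ‖q‖ < 1) (R : ℝ) :
    ∃ C : ℝ, 1 ≤ C ∧ ∀ x : ℂ, ‖x‖ ≤ R → ∀ n : ℕ, ‖qFac x q n‖ ≤ C := by
  refine ⟨Real.exp (|R| * (1 - ‖q‖)⁻¹), Real.one_le_exp ?_, fun x hx n => ?_⟩
  · have : 0 ≤ (1 - ‖q‖)⁻¹ := inv_nonneg.mpr (by linarith)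
    positivity
  · rw [qFac, norm_prod]
    calc ∏ k ∈ Finset.range n, ‖1 - x * q ^ k‖
        ≤ ∏ k ∈ Finset.range n, Real.exp (|R| * ‖q‖ ^ k) := by
          refine Finset.prod_le_prod (fun _ _ => norm_nonneg _) fun k _ => ?_
          refine (norm_sub_le _ _).trans ?_
          rw [norm_one, norm_mul, norm_pow, add_comm]
          refine le_trans ?_ (Real.add_one_le_exp _)
          gcongr
          exact hx.trans (le_abs_self R)
      _ = Real.exp (|R| * ∑ k ∈ Finset.range n, ‖q‖ ^ k) := by
          rw [← Real.exp_sum, Finset.mul_sum]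
      _ ≤ _ := by
          gcongr
          exact geom_partial_le (norm_nonneg q) hq n

/-- Weierstrass' inequality `∏ (1 - t_k) ≥ 1 - ∑ t_k`, with the sum bounded by a geometric series.
-/
theorem one_sub_le_norm_qFac {x q : ℂ} (hq : ‖q‖ < 1) (h : ‖x‖ * (1 - ‖q‖)⁻¹ ≤ 1 / 2) (n : ℕ) :
    1 / 2 ≤ ‖qFac x q n‖ := by
  have hs : ∀ n, ‖x‖ * ∑ k ∈ Finset.range n, ‖q‖ ^ k ≤ 1 / 2 := fun n =>
    (mul_le_mul_of_nonneg_left (geom_partial_le (norm_nonneg q) hq n) (norm_nonneg x)).trans h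
  suffices H : ∀ n, 1 - ‖x‖ * ∑ k ∈ Finset.range n, ‖q‖ ^ k ≤ ‖qFac x q n‖ by
    linarith [H n, hs n]
  intro n
  induction n with
  | zero => simp
  | succ n ih =>
    have h1 := hs n
    have h2 := hs (n + 1)
    rw [Finset.sum_range_succ, mul_add] at h2 ⊢
    rw [qFac_succ, norm_mul]
    have h3 : 1 - ‖x‖ * ‖q‖ ^ n ≤ ‖1 - x * q ^ n‖ := by
      have := norm_sub_norm_le (1 : ℂ) (x * q ^ n)
      rwa [norm_one, norm_mul, norm_pow] at this
    have h4 : 0 ≤ ‖x‖ * ∑ k ∈ Finset.range n, ‖q‖ ^ k := by positivity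
    have h5 : 0 ≤ ‖x‖ * ‖q‖ ^ n := by positivity
    calc _ ≤ (1 - ‖x‖ * ∑ k ∈ Finset.range n, ‖q‖ ^ k) * (1 - ‖x‖ * ‖q‖ ^ n) := by
          nlinarith
      _ ≤ _ := mul_le_mul ih h3 (by linarith) (norm_nonneg _)

theorem continuous_qFac (q : ℂ) (n : ℕ) : Continuous fun x => qFac x q n := by
  unfold qFac
  fun_prop

/-- The reciprocals of the finite `q`-shifted factorials are locally uniformly bounded. -/
theorem eventually_norm_inv_qFac_le {x₀ q : ℂ} (hq : ‖q‖ < 1) (h : ∀ k : ℕ, x₀ * q ^ k ≠ 1) :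
    ∃ C : ℝ, 1 ≤ C ∧ ∀ᶠ x in 𝓝 x₀, ∀ n : ℕ, qFac x q n ≠ 0 ∧ ‖(qFac x q n)⁻¹‖ ≤ C := by
  -- Beyond this `N` the tail product has norm at least `1 / 2` for every `x` with `‖x‖ < ‖x₀‖ + 1`.
  -- The finitely many orders up to `N` are handled by continuity; the factor `2` below pays for the
  -- tail.
  obtain ⟨N, hN⟩ : ∃ N : ℕ, (‖x₀‖ + 1) * ‖q‖ ^ N * (1 - ‖q‖)⁻¹ < 1 / 2 := by
    have ht : Tendsto (fun N : ℕ => (‖x₀‖ + 1) * ‖q‖ ^ N * (1 - ‖q‖)⁻¹) atTop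
        (𝓝 ((‖x₀‖ + 1) * 0 * (1 - ‖q‖)⁻¹)) :=
      ((tendsto_pow_atTop_nhds_zero_of_lt_one (norm_nonneg q) hq).const_mul _).mul_const _
    rw [mul_zero, zero_mul] at ht
    exact (ht.eventually (gt_mem_nhds (by norm_num))).exists
  have hsum : ∀ n ≤ N, ‖(qFac x₀ q n)⁻¹‖ + 1 ≤
      ∑ i ∈ Finset.range (N + 1), (‖(qFac x₀ q i)⁻¹‖ + 1) := fun n hn =>
    Finset.single_le_sum (f := fun i => ‖(qFac x₀ q i)⁻¹‖ + 1) (fun _ _ => by positivity)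
      (Finset.mem_range.mpr (by omega))
  refine ⟨2 * ∑ i ∈ Finset.range (N + 1), (‖(qFac x₀ q i)⁻¹‖ + 1), ?_, ?_⟩
  · have := hsum 0 (Nat.zero_le _)
    simp only [qFac_zero, inv_one, norm_one] at this
    linarith
  have h1 : ∀ᶠ x in 𝓝 x₀, ∀ n ∈ Finset.range (N + 1),
      qFac x q n ≠ 0 ∧ ‖(qFac x q n)⁻¹‖ ≤ ‖(qFac x₀ q n)⁻¹‖ + 1 := by
    rw [eventually_all_finset]
    intro n _
    have hne := qFac_ne_zero h n
    have hc := (continuous_qFac q n).continuousAt (x := x₀)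
    refine (hc.eventually_ne hne).and ?_
    have := (hc.inv₀ hne).norm.eventually (gt_mem_nhds (lt_add_one _))
    exact this.mono fun x hx => hx.le
  have h2 : ∀ᶠ x in 𝓝 x₀, ‖x‖ < ‖x₀‖ + 1 :=
    continuous_norm.continuousAt.eventually (gt_mem_nhds (lt_add_one _))
  filter_upwards [h1, h2] with x hx1 hx2 n
  have hpos : 0 ≤ ∑ i ∈ Finset.range (N + 1), (‖(qFac x₀ q i)⁻¹‖ + 1) := by positivity
  rcases le_or_gt n N with hn | hn
  · obtain ⟨a1, a2⟩ := hx1 n (Finset.mem_range.mpr (by omega))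
    exact ⟨a1, by linarith [hsum n hn]⟩
  · obtain ⟨m, rfl⟩ := Nat.exists_eq_add_of_lt hn
    obtain ⟨a1, a2⟩ := hx1 N (Finset.mem_range.mpr (by omega))
    rw [add_assoc, qFac_add]
    have hb : 1 / 2 ≤ ‖qFac (x * q ^ N) q (m + 1)‖ := by
      refine one_sub_le_norm_qFac hq (le_trans ?_ hN.le) _
      rw [norm_mul, norm_pow]
      have : 0 ≤ (1 - ‖q‖)⁻¹ := inv_nonneg.mpr (by linarith)
      gcongr
    have hb0 : qFac (x * q ^ N) q (m + 1) ≠ 0 := by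
      rw [← norm_pos_iff]; linarith
    refine ⟨mul_ne_zero a1 hb0, ?_⟩
    rw [mul_inv, norm_mul, mul_comm]
    have hb' : ‖(qFac (x * q ^ N) q (m + 1))⁻¹‖ ≤ 2 := by
      rw [norm_inv, inv_le_comm₀ (by linarith) (by norm_num)]
      linarith
    exact mul_le_mul hb' (a2.trans (hsum N le_rfl)) (norm_nonneg _) (by norm_num)

theorem exists_norm_inv_qFac_le {x q : ℂ} (hq : ‖q‖ < 1) (h : ∀ k : ℕ, x * q ^ k ≠ 1) :
    ∃ C : ℝ, 1 ≤ C ∧ ∀ n : ℕ, ‖(qFac x q n)⁻¹‖ ≤ C := by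
  obtain ⟨C, h1, h2⟩ := eventually_norm_inv_qFac_le hq h
  exact ⟨C, h1, fun n => (h2.self_of_nhds n).2⟩

/-- Since `(xq^N; q)_n = (x; q)_(N+n) / (x; q)_N`, one constant serves all shifts `N`. This is what
lets `N → ∞` in the iterated `₆φ₅` relation. -/
theorem exists_norm_inv_qFac_shift_le {x q : ℂ} (hq : ‖q‖ < 1) (h : ∀ k : ℕ, x * q ^ k ≠ 1) :
    ∃ C : ℝ, 1 ≤ C ∧ ∀ N n : ℕ, ‖(qFac (x * q ^ N) q n)⁻¹‖ ≤ C := by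
  obtain ⟨C, h1, h2⟩ := exists_norm_inv_qFac_le hq h
  obtain ⟨D, h3, h4⟩ := exists_norm_qFac_le hq ‖x‖
  refine ⟨C * D, by nlinarith, fun N n => ?_⟩
  have e : (qFac (x * q ^ N) q n)⁻¹ = (qFac x q (N + n))⁻¹ * qFac x q N := by
    have := qFac_ne_zero h N
    rw [qFac_add, mul_inv]
    field_simp
  rw [e, norm_mul]
  exact mul_le_mul (h2 _) (h4 x le_rfl N) (norm_nonneg _) (by linarith)

theorem exists_norm_vwpFac_le {q : ℂ} (hq : ‖q‖ < 1) (R : ℝ) :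
    ∃ C : ℝ, 1 ≤ C ∧ ∀ x : ℂ, ‖x‖ ≤ R → ∀ n : ℕ, ‖vwpFac x q n‖ ≤ C := by
  obtain ⟨D, h3, h4⟩ := exists_norm_qFac_le hq |R|
  refine ⟨(1 + |R|) * D, by nlinarith [abs_nonneg R], fun x hx n => ?_⟩
  have hx' := hx.trans (le_abs_self R)
  cases n with
  | zero => simp only [vwpFac, norm_one]; nlinarith [abs_nonneg R]
  | succ n =>
    rw [vwpFac, norm_mul]
    refine mul_le_mul ?_ (h4 _ ?_ _) (norm_nonneg _) (by positivity)
    · refine (norm_sub_le _ _).trans ?_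
      rw [norm_one, norm_mul, norm_pow]
      have := pow_le_one₀ (n := 2 * (n + 1)) (norm_nonneg q) hq.le
      nlinarith [norm_nonneg x]
    · rw [norm_mul]
      nlinarith [norm_nonneg x]

theorem tendsto_qFac (x : ℂ) {q : ℂ} (hq : ‖q‖ < 1) :
    Tendsto (qFac x q) atTop (𝓝 (qPochInf x q)) :=
  (multipliable_qPochInf x hq).hasProd.tendsto_prod_nat

theorem qPochInf_eq_qFac_mul (x : ℂ) {q : ℂ} (hq : ‖q‖ < 1) (n : ℕ) :
    qPochInf x q = qFac x q n * qPochInf (x * q ^ n) q :=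
  (qPochInf_split x hq n).symm

theorem qPochInf_ne_zero {x q : ℂ} (hq : ‖q‖ < 1) (h : ∀ k : ℕ, x * q ^ k ≠ 1) :
    qPochInf x q ≠ 0 := by
  obtain ⟨C, h1, h2⟩ := exists_norm_inv_qFac_le hq h
  have h3 : ∀ n, C⁻¹ ≤ ‖qFac x q n‖ := fun n => by
    have := h2 n
    rw [norm_inv] at this
    exact (inv_le_comm₀ (norm_pos_iff.mpr (qFac_ne_zero h n)) (by linarith)).mp this
  have h4 := ge_of_tendsto' (tendsto_qFac x hq).norm h3
  have : 0 < C⁻¹ := by positivity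
  rw [← norm_pos_iff]
  linarith

/-! ### The nonterminating very-well-poised `₆φ₅` sum. -/

section
variable {a b c d q x : ℂ} (hq1 : ‖q‖ < 1) (hb : b ≠ 0) (hc : c ≠ 0) (hd : d ≠ 0)
  (hx : a * q = b * c * d * x) (hx1 : ‖x‖ < 1) (haq : ∀ k : ℕ, a * q * q ^ k ≠ 1)
  (hab : ∀ k : ℕ, a * q / b * q ^ k ≠ 1) (hac : ∀ k : ℕ, a * q / c * q ^ k ≠ 1)
  (had : ∀ k : ℕ, a * q / d * q ^ k ≠ 1)

include hq1 in
theorem mul_pow_ne_one_of_norm_lt_one {x : ℂ} (hx : ‖x‖ < 1) (k : ℕ) : x * q ^ k ≠ 1 := by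
  intro h
  have := congrArg norm h
  rw [norm_mul, norm_pow, norm_one] at this
  have h2 := pow_le_one₀ (n := k) (norm_nonneg q) hq1.le
  nlinarith [norm_nonneg x]

include hq1 hab hac had in
theorem exists_norm_sixTerm_le : ∃ C : ℝ, ∀ N m : ℕ,
    ‖sixTerm (a * q ^ N) b c d q (x * q ^ N) m‖ ≤ C * ‖x * q ^ N‖ ^ m := by
  obtain ⟨C1, p1, h1⟩ := exists_norm_vwpFac_le hq1 ‖a‖
  obtain ⟨C2, p2, h2⟩ := exists_norm_qFac_le hq1 ‖b‖
  obtain ⟨C3, p3, h3⟩ := exists_norm_qFac_le hq1 ‖c‖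
  obtain ⟨C4, p4, h4⟩ := exists_norm_qFac_le hq1 ‖d‖
  obtain ⟨C5, p5, h5⟩ := exists_norm_inv_qFac_le hq1 (mul_pow_ne_one_of_norm_lt_one hq1 hq1)
  obtain ⟨C6, p6, h6⟩ := exists_norm_inv_qFac_shift_le hq1 hab
  obtain ⟨C7, p7, h7⟩ := exists_norm_inv_qFac_shift_le hq1 hac
  obtain ⟨C8, p8, h8⟩ := exists_norm_inv_qFac_shift_le hq1 had
  refine ⟨C1 * (C2 * C3 * C4) * (C5 * (C6 * C7 * C8)), fun N m => ?_⟩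
  have e : ∀ y, a * q ^ N * q / y = a * q / y * q ^ N := fun y => by ring
  have hN : ‖a * q ^ N‖ ≤ ‖a‖ := by
    rw [norm_mul, norm_pow]
    exact mul_le_of_le_one_right (norm_nonneg a) (pow_le_one₀ (norm_nonneg q) hq1.le)
  rw [sixTerm, div_eq_mul_inv, e, e, e]
  simp only [mul_inv, norm_mul, norm_pow]
  simp only [norm_mul, norm_pow] at h1 h2 h3 h4 h5 h6 h7 h8 hN
  gcongr
  · exact h1 _ (by simpa using hN) m
  · exact h2 _ le_rfl m
  · exact h3 _ le_rfl m
  · exact h4 _ le_rfl m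
  · exact h5 m
  · exact h6 N m
  · exact h7 N m
  · exact h8 N m

include hq1 hx1 hab hac had in
theorem summable_sixTerm (N : ℕ) : Summable (sixTerm (a * q ^ N) b c d q (x * q ^ N)) := by
  obtain ⟨C, h⟩ := exists_norm_sixTerm_le (x := x) hq1 hab hac had
  refine Summable.of_norm_bounded ?_ (h N)
  refine (summable_geometric_of_lt_one (norm_nonneg _) ?_).mul_left C
  rw [norm_mul, norm_pow]
  have h2 := pow_le_one₀ (n := N) (norm_nonneg q) hq1.le
  nlinarith [norm_nonneg x]

include hq1 hb hc hd hx hx1 haq hab hac had in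
theorem tsum_sixTerm_eq_mul_shift :
    ∑' m, sixTerm a b c d q x m =
      (1 - a * q) * (1 - d * x) * (1 - c * x) * (1 - b * x) /
        ((1 - a * q / b) * (1 - a * q / c) * (1 - a * q / d) * (1 - x)) *
        ∑' m, sixTerm (a * q) b c d q (x * q) m := by
  have hqk := mul_pow_ne_one_of_norm_lt_one hq1 hq1
  have hx1' : x ≠ 1 := by rintro rfl; simp at hx1
  have h0 : Summable (sixTerm a b c d q x) := by
    simpa using summable_sixTerm (x := x) hq1 hx1 hab hac had 0
  have h1 : Summable (sixTerm (a * q) b c d q (x * q)) := by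
    simpa using summable_sixTerm (x := x) hq1 hx1 hab hac had 1
  have t0 := (tendsto_add_atTop_iff_nat 1).mpr h0.hasSum.tendsto_sum_nat
  have t1 := (tendsto_add_atTop_iff_nat 1).mpr h1.hasSum.tendsto_sum_nat
  have hlim : ∀ y, Tendsto (fun M => qFac y q (M + 1)) atTop (𝓝 (qPochInf y q)) := fun y =>
    (tendsto_add_atTop_iff_nat 1).mpr (tendsto_qFac y hq1)
  have hxl : Tendsto (fun M => x ^ (M + 1)) atTop (𝓝 0) :=
    (tendsto_add_atTop_iff_nat 1).mpr (tendsto_pow_atTop_nhds_zero_of_norm_lt_one hx1)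
  have hql : Tendsto (fun M => q ^ (M + 1)) atTop (𝓝 0) :=
    (tendsto_add_atTop_iff_nat 1).mpr (tendsto_pow_atTop_nhds_zero_of_norm_lt_one hq1)
  have hne : qPochInf q q * (qPochInf (a * q / b) q * qPochInf (a * q / c) q *
      qPochInf (a * q / d) q) * (1 - x) ≠ 0 :=
    mul_ne_zero (mul_ne_zero (qPochInf_ne_zero hq1 hqk) (mul_ne_zero (mul_ne_zero
      (qPochInf_ne_zero hq1 hab) (qPochInf_ne_zero hq1 hac)) (qPochInf_ne_zero hq1 had)))
      (sub_ne_zero.mpr hx1'.symm)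
  have tg := (((((tendsto_qFac (a * q) hq1).mul (((hlim b).mul (hlim c)).mul (hlim d))).mul
    hxl).mul ((hql.const_mul (a * x)).const_sub 1))).div
    (((tendsto_qFac q hq1).mul (((hlim (a * q / b)).mul (hlim (a * q / c))).mul
      (hlim (a * q / d)))).mul_const (1 - x)) hne
  have := tendsto_nhds_unique t0 (((t1.const_mul ((1 - a * q) * (1 - d * x) * (1 - c * x) *
    (1 - b * x) / ((1 - a * q / b) * (1 - a * q / c) * (1 - a * q / d) * (1 - x)))).sub tg).congr
    fun M => (sixTerm_telescope hb hc hd hx hx1' hqk (by simpa using haq 0) hab hac had M).symm)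
  simpa using this

include hq1 hb hc hd hx hx1 haq hab hac had in
theorem tsum_sixTerm_eq_mul_shift_pow (N : ℕ) :
    ∑' m, sixTerm a b c d q x m =
      qFac (a * q) q N * qFac (d * x) q N * qFac (c * x) q N * qFac (b * x) q N /
        (qFac (a * q / b) q N * qFac (a * q / c) q N * qFac (a * q / d) q N * qFac x q N) *
        ∑' m, sixTerm (a * q ^ N) b c d q (x * q ^ N) m := by
  induction N with
  | zero => simp
  | succ N ih =>
    have e : ∀ y k, a * q ^ N * q / y * q ^ k = a * q / y * q ^ (N + k) := fun y k => by ring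
    have hxN : ‖x * q ^ N‖ < 1 := by
      rw [norm_mul, norm_pow]
      have h2 := pow_le_one₀ (n := N) (norm_nonneg q) hq1.le
      nlinarith [norm_nonneg x]
    rw [ih, tsum_sixTerm_eq_mul_shift (a := a * q ^ N) (x := x * q ^ N) hq1 hb hc hd
      (by linear_combination q ^ N * hx) hxN
      (fun k => by rw [show a * q ^ N * q * q ^ k = a * q * q ^ (N + k) by ring]; exact haq _)
      (fun k => by rw [e]; exact hab _) (fun k => by rw [e]; exact hac _)
      (fun k => by rw [e]; exact had _), ← mul_assoc]
    congr 1
    · rw [div_mul_div_comm]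
      simp only [qFac_succ]
      congr 1 <;> ring
    · simp only [pow_succ, mul_assoc]

include hq1 hb hc hd hx hx1 haq hab hac had in
/-- The nonterminating very-well-poised `₆φ₅` sum. -/
theorem tsum_sixTerm :
    ∑' m, sixTerm a b c d q x m =
      qPochInf (a * q) q * qPochInf (d * x) q * qPochInf (c * x) q * qPochInf (b * x) q /
        (qPochInf (a * q / b) q * qPochInf (a * q / c) q * qPochInf (a * q / d) q *
          qPochInf x q) := by
  obtain ⟨C, h⟩ := exists_norm_sixTerm_le (x := x) hq1 hab hac had
  have hC : 0 ≤ C := by simpa using (norm_nonneg _).trans (h 0 0)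
  have hb : ∀ N m, ‖sixTerm (a * q ^ N) b c d q (x * q ^ N) m‖ ≤ C * ‖x‖ ^ m := fun N m => by
    refine (h N m).trans ?_
    gcongr
    rw [norm_mul, norm_pow]
    exact mul_le_of_le_one_right (norm_nonneg x) (pow_le_one₀ (norm_nonneg q) hq1.le)
  have hq0 := tendsto_pow_atTop_nhds_zero_of_norm_lt_one hq1
  -- As `N → ∞` the argument `x q ^ N` tends to `0`, so only the term `m = 0`, equal to `1`,
  -- survives; the iterated prefactors then give the infinite products.
  have hterm : ∀ m, Tendsto (fun N => sixTerm (a * q ^ N) b c d q (x * q ^ N) m) atTop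
      (𝓝 (if m = 0 then 1 else 0)) := by
    intro m
    rcases Nat.eq_zero_or_pos m with rfl | hm
    · simp [sixTerm, vwpFac]
    · rw [if_neg hm.ne']
      refine squeeze_zero_norm (fun N => h N m) ?_
      have := (((hq0.const_mul x).norm).pow m).const_mul C
      simpa [hm.ne'] using this
  have hT := tendsto_tsum_of_dominated_convergence
    ((summable_geometric_of_lt_one (norm_nonneg x) hx1).mul_left C) hterm
    (Eventually.of_forall hb)
  rw [tsum_ite_eq] at hT
  have hne : qPochInf (a * q / b) q * qPochInf (a * q / c) q * qPochInf (a * q / d) q *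
      qPochInf x q ≠ 0 :=
    mul_ne_zero (mul_ne_zero (mul_ne_zero
      (qPochInf_ne_zero hq1 hab) (qPochInf_ne_zero hq1 hac)) (qPochInf_ne_zero hq1 had))
      (qPochInf_ne_zero hq1 (mul_pow_ne_one_of_norm_lt_one hq1 hx1))
  have hl := fun y => tendsto_qFac y hq1
  have := ((((((hl (a * q)).mul (hl (d * x))).mul (hl (c * x))).mul (hl (b * x))).div
    ((((hl (a * q / b)).mul (hl (a * q / c))).mul (hl (a * q / d))).mul (hl x)) hne).mul hT).congr
    fun N => (tsum_sixTerm_eq_mul_shift_pow hq1 ‹_› hc hd hx hx1 haq hab hac had N).symm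
  simpa using tendsto_nhds_unique tendsto_const_nhds this

end

/-! ### The double series and its sums by antidiagonals and by rows. -/

/-- The weight `lim_{a → 1} (1 - a q ^ (2n)) (a; q)_n / ((1 - a) (q; q)_n)`. -/
def foldWeight (q : ℂ) (n : ℕ) : ℂ := if n = 0 then 1 else 1 + q ^ n

/-- The terms of the folded bilateral series at `a = 1`. -/
def foldTerm (c d e z q : ℂ) (n : ℕ) : ℂ :=
  foldWeight q n * (qFac c q n * qFac d q n * qFac e q n * qFac (1 / z) q n * qFac z q n) /
    (qFac (q / c) q n * qFac (q / d) q n * qFac (q / e) q n * qFac (z * q) q n *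
      qFac (q / z) q n) * (q / z) ^ n

/-- The terms of the very-well-poised `₈φ₇` with argument `q`. -/
def eightTerm (c d e z q : ℂ) (k : ℕ) : ℂ :=
  vwpFac (1 / z) q k * (qFac (c / z) q k * qFac (d / z) q k * qFac (e / z) q k *
    qFac (1 / z) q k * qFac z q k) /
    (qFac q q k * (qFac (q / c) q k * qFac (q / d) q k * qFac (q / e) q k * qFac q q k *
      qFac (q / z ^ 2) q k)) * q ^ k

/-- The double series which is summed by rows and by antidiagonals. -/
def doubleTerm (c d e z q : ℂ) (p : ℕ × ℕ) : ℂ :=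
  foldWeight q (p.1 + p.2) * (qFac (1 / z) q (p.1 + p.2) * qFac z q (p.1 + p.2)) /
    (qFac (z * q) q (p.1 + p.2) * qFac (q / z) q (p.1 + p.2)) * (q / z) ^ (p.1 + p.2) *
    jacksonTerm c d e z q p.1 p.2

/-- The source is `(1 + q^n)(1 - q^n) = 1 - q^(2n)` with `n = k + m`: it turns the folding weight
into the very-well-poised factor with `a = q^(2k)`. The cases `m = 0` and `k = m = 0` are separate
because the weights are special there. -/
theorem foldWeight_mul (q : ℂ) (k m : ℕ) :
    foldWeight q (k + m) * qFac q q (k + m) * qFac (q ^ (k + m)) q k =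
      qFac q q (k + k) * vwpFac (q ^ (k + k)) q m := by
  rcases m with _ | m
  · rcases k with _ | k
    · simp [foldWeight, vwpFac]
    · have h := qFac_add q q k (k + 1)
      rw [← pow_succ' q k] at h
      have h2 := qFac_succ q q (k + (k + 1))
      rw [show k + (k + 1) + 1 = k + 1 + (k + 1) by ring] at h2
      simp only [add_zero, foldWeight, vwpFac, if_neg (Nat.succ_ne_zero k)]
      rw [h2, h, qFac_succ]
      ring
  · have h := qFac_add q q (k + m) k
    rw [← pow_succ' q (k + m)] at h
    have h2 := qFac_add q q (k + k) m
    rw [show k + k + m = k + m + k by ring, h] at h2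
    simp only [foldWeight, vwpFac, ← add_assoc, if_neg (Nat.succ_ne_zero (k + m))]
    rw [qFac_succ, mul_comm _ q]
    linear_combination (1 - q ^ (k + k) * q ^ (2 * (m + 1))) * h2

theorem norm_foldWeight_le {q : ℂ} (hq : ‖q‖ < 1) (n : ℕ) : ‖foldWeight q n‖ ≤ 2 := by
  unfold foldWeight
  split_ifs
  · simp
  · refine (norm_add_le _ _).trans ?_
    rw [norm_one, norm_pow]
    linarith [pow_le_one₀ (n := n) (norm_nonneg q) hq.le]

section
variable {c d e z q : ℂ} (hq1 : ‖q‖ < 1) (hc0 : c ≠ 0) (hd0 : d ≠ 0) (he0 : e ≠ 0) (hz0 : z ≠ 0)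
  (hq0 : q ≠ 0) (hz : c * d * e = z * q) (hqz1 : ‖q / z‖ < 1)
  (hc : ∀ k : ℕ, q / c * q ^ k ≠ 1) (hd : ∀ k : ℕ, q / d * q ^ k ≠ 1)
  (he : ∀ k : ℕ, q / e * q ^ k ≠ 1) (hzq : ∀ k : ℕ, z * q * q ^ k ≠ 1)
  (hzz : ∀ k : ℕ, q / z ^ 2 * q ^ k ≠ 1)

include hq1 hc0 hd0 he0 hz0 hq0 hz hqz1 hc hd he in
theorem sum_antidiagonal_doubleTerm (n : ℕ) :
    ∑ p ∈ Finset.HasAntidiagonal.antidiagonal n, doubleTerm c d e z q p =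
      foldTerm c d e z q n := by
  have h : ∀ p ∈ Finset.HasAntidiagonal.antidiagonal n, doubleTerm c d e z q p =
      foldWeight q n * (qFac (1 / z) q n * qFac z q n) /
        (qFac (z * q) q n * qFac (q / z) q n) * (q / z) ^ n * jacksonTerm c d e z q p.1 p.2 :=
    fun p hp => by rw [doubleTerm, Finset.HasAntidiagonal.mem_antidiagonal.mp hp]
  rw [Finset.sum_congr rfl h, ← Finset.mul_sum,
    jackson_sum hc0 hd0 he0 hz0 hq0 hz (mul_pow_ne_one_of_norm_lt_one hq1 hq1) hc hd he
      (mul_pow_ne_one_of_norm_lt_one hq1 hqz1), foldTerm]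
  simp only [div_eq_mul_inv, mul_inv]
  ring

include hq1 hqz1 hc hd he hzq hz0 in
theorem summable_doubleTerm : Summable (doubleTerm c d e z q) := by
  have hqq := mul_pow_ne_one_of_norm_lt_one hq1 hq1
  have hqz := mul_pow_ne_one_of_norm_lt_one hq1 hqz1
  obtain ⟨A1, p1, h1⟩ := exists_norm_vwpFac_le hq1 ‖1 / z‖
  obtain ⟨A2, p2, h2⟩ := exists_norm_qFac_le hq1 ‖c / z‖
  obtain ⟨A3, p3, h3⟩ := exists_norm_qFac_le hq1 ‖d / z‖
  obtain ⟨A4, p4, h4⟩ := exists_norm_qFac_le hq1 ‖e / z‖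
  obtain ⟨A5, p5, h5⟩ := exists_norm_qFac_le hq1 ‖1 / z‖
  obtain ⟨A6, p6, h6⟩ := exists_norm_qFac_le hq1 ‖z‖
  obtain ⟨A7, p7, h7⟩ := exists_norm_qFac_le hq1 1
  obtain ⟨B1, r1, i1⟩ := exists_norm_inv_qFac_le hq1 hqq
  obtain ⟨B2, r2, i2⟩ := exists_norm_inv_qFac_le hq1 hc
  obtain ⟨B3, r3, i3⟩ := exists_norm_inv_qFac_le hq1 hd
  obtain ⟨B4, r4, i4⟩ := exists_norm_inv_qFac_le hq1 he
  obtain ⟨B5, r5, i5⟩ := exists_norm_inv_qFac_le hq1 hzq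
  obtain ⟨B6, r6, i6⟩ := exists_norm_inv_qFac_le hq1 hqz
  have hb : ∀ p, ‖doubleTerm c d e z q p‖ ≤
      2 * (A5 * A6) * (B5 * B6) * (A1 * (A2 * A3 * A4) * (B1 * (B2 * B3 * B4)) *
        (A7 * A6 * A7 * (B1 * B6))) * (‖q‖ ^ p.1 * ‖q / z‖ ^ p.2) := by
    rintro ⟨k, m⟩
    have e1 : doubleTerm c d e z q (k, m) =
      foldWeight q (k + m) * (qFac (1 / z) q (k + m) * qFac z q (k + m)) *
      ((qFac (z * q) q (k + m))⁻¹ * (qFac (q / z) q (k + m))⁻¹) *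
      (vwpFac (1 / z) q k * (qFac (c / z) q k * qFac (d / z) q k * qFac (e / z) q k) *
      ((qFac q q k)⁻¹ * ((qFac (q / c) q k)⁻¹ * (qFac (q / d) q k)⁻¹ * (qFac (q / e) q k)⁻¹)) *
      (qFac q q (k + m) * qFac z q m * qFac (q ^ (k + m)) q k *
      ((qFac q q m)⁻¹ * (qFac (q / z) q (k + m + k))⁻¹))) * (q ^ k * (q / z) ^ m) := by
      -- Hence `(q/z)^(k+m) z^k = q^k (q/z)^m`, which is geometric in both indices; everything else
      -- is bounded.
      have : (q / z) ^ k * z ^ k = q ^ k := by rw [← mul_pow, div_mul_cancel₀ _ hz0]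
      simp only [doubleTerm, jacksonTerm, ← this, pow_add, div_eq_mul_inv, mul_inv]
      ring
    have hqn : ‖q ^ (k + m)‖ ≤ 1 := by
      rw [norm_pow]; exact pow_le_one₀ (norm_nonneg q) hq1.le
    rw [e1]
    simp only [norm_mul, norm_pow]
    have w := norm_foldWeight_le hq1 (k + m)
    have w1 := h1 _ le_rfl k
    have w2 := h2 _ le_rfl k
    have w3 := h3 _ le_rfl k
    have w4 := h4 _ le_rfl k
    have w5 := h5 _ le_rfl (k + m)
    have w6 := h6 _ le_rfl (k + m)
    have w7 := h7 q hq1.le (k + m)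
    have w8 := h6 _ le_rfl m
    have w9 := h7 _ hqn k
    have v1 := i1 k
    have v2 := i2 k
    have v3 := i3 k
    have v4 := i4 k
    have v5 := i5 (k + m)
    have v6 := i6 (k + m)
    have v7 := i1 m
    have v8 := i6 (k + m + k)
    gcongr
  refine Summable.of_norm_bounded (Summable.mul_left _ ?_) hb
  exact (summable_geometric_of_lt_one (norm_nonneg _) hq1).mul_of_nonneg
    (summable_geometric_of_lt_one (norm_nonneg _) hqz1) (fun _ => by positivity)
    (fun _ => by positivity)

include hz0 hq0 in
-- Splitting `(y; q)_(k+m) = (y; q)_k (yq^k; q)_m` isolates the dependence on `m`. The row `k = 0`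
-- has `a = 1`, which is why `sixTerm` uses `vwpFac` and not a quotient by `1 - a`.
theorem doubleTerm_eq_mul_sixTerm (k m : ℕ) :
    doubleTerm c d e z q (k, m) =
      vwpFac (1 / z) q k * (qFac (c / z) q k * qFac (d / z) q k * qFac (e / z) q k) /
      (qFac q q k * (qFac (q / c) q k * qFac (q / d) q k * qFac (q / e) q k)) *
      (qFac q q (k + k) * (qFac (1 / z) q k * qFac z q k) /
        (qFac (z * q) q k * qFac (q / z) q k * qFac (q / z) q (k + k))) * ((q / z) ^ k * z ^ k) *
      sixTerm (q ^ (k + k)) z (q ^ k / z) (z * q ^ k) q (q / z) m := by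
  have t1 : q ^ (k + k) * q / z = q / z * q ^ (k + k) := by ring
  have t2 : q ^ (k + k) * q / (q ^ k / z) = z * q * q ^ k := by field_simp; ring
  have t3 : q ^ (k + k) * q / (z * q ^ k) = q / z * q ^ k := by field_simp; ring
  have t4 : q ^ k / z = 1 / z * q ^ k := by ring
  rw [doubleTerm, jacksonTerm, sixTerm, t1, t2, t3, t4]
  dsimp only
  rw [qFac_add (1 / z), qFac_add z, qFac_add (z * q), qFac_add (q / z) q k m,
    show k + m + k = k + k + m by ring, qFac_add (q / z) q (k + k) m, pow_add (q / z)]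
  simp only [div_eq_mul_inv _ (_ * _), mul_inv]
  have := foldWeight_mul q k m
  generalize foldWeight q (k + m) = y1 at *
  generalize qFac q q (k + m) = y2 at *
  generalize qFac (q ^ (k + m)) q k = y3 at *
  generalize qFac q q (k + k) = y4 at *
  generalize vwpFac (q ^ (k + k)) q m = y5 at *
  linear_combination (qFac (1 / z) q k * qFac (1 / z * q ^ k) q m * (qFac z q k *
    qFac (z * q ^ k) q m)) * ((qFac (z * q) q k)⁻¹ * (qFac (z * q * q ^ k) q m)⁻¹ *
    ((qFac (q / z) q k)⁻¹ * (qFac (q / z * q ^ k) q m)⁻¹)) * ((q / z) ^ k * (q / z) ^ m) *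
    (vwpFac (1 / z) q k * (qFac (c / z) q k * qFac (d / z) q k * qFac (e / z) q k) *
    ((qFac q q k)⁻¹ * ((qFac (q / c) q k)⁻¹ * (qFac (q / d) q k)⁻¹ * (qFac (q / e) q k)⁻¹)) *
    z ^ k * (qFac z q m * ((qFac q q m)⁻¹ * ((qFac (q / z) q (k + k))⁻¹ *
    (qFac (q / z * q ^ (k + k)) q m)⁻¹)))) * this

include hq1 hz0 hq0 hqz1 hc hd he hzq hzz in
theorem tsum_doubleTerm_row (k : ℕ) :
    ∑' m, doubleTerm c d e z q (k, m) =
      qPochInf q q ^ 3 * qPochInf (q / z ^ 2) q / (qPochInf (z * q) q * qPochInf (q / z) q ^ 3) *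
        eightTerm c d e z q k := by
  have hqq := mul_pow_ne_one_of_norm_lt_one hq1 hq1
  have hqz := mul_pow_ne_one_of_norm_lt_one hq1 hqz1
  have t1 : q ^ (k + k) * q / z = q / z * q ^ (k + k) := by ring
  have t2 : q ^ (k + k) * q / (q ^ k / z) = z * q * q ^ k := by field_simp; ring
  have t3 : q ^ (k + k) * q / (z * q ^ k) = q / z * q ^ k := by field_simp; ring
  have t4 : q ^ (k + k) * q = q * q ^ (k + k) := mul_comm _ _
  have t5 : z * q ^ k * (q / z) = q * q ^ k := by field_simp
  have t6 : q ^ k / z * (q / z) = q / z ^ 2 * q ^ k := by field_simp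
  have t7 : z * (q / z) = q := by field_simp
  have hsix := tsum_sixTerm (a := q ^ (k + k)) (b := z) (c := q ^ k / z) (d := z * q ^ k)
    (x := q / z) hq1 hz0 (div_ne_zero (pow_ne_zero k hq0) hz0)
    (mul_ne_zero hz0 (pow_ne_zero k hq0)) (by field_simp; ring) hqz1
    (fun j => by rw [t4, mul_assoc, ← pow_add]; exact hqq _)
    (fun j => by rw [t1, mul_assoc, ← pow_add]; exact hqz _)
    (fun j => by rw [t2, mul_assoc, ← pow_add]; exact hzq _)
    (fun j => by rw [t3, mul_assoc, ← pow_add]; exact hqz _)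
  have t8 : (q / z) ^ k * z ^ k = q ^ k := by rw [← mul_pow, div_mul_cancel₀ _ hz0]
  simp only [doubleTerm_eq_mul_sixTerm hz0 hq0, tsum_mul_left]
  rw [hsix, t1, t2, t3, t4, t5, t6, t7, t8]
  have s1 := qPochInf_eq_qFac_mul q hq1 (k + k)
  have s2 := qPochInf_eq_qFac_mul q hq1 k
  have s3 := qPochInf_eq_qFac_mul (q / z ^ 2) hq1 k
  have s4 := qPochInf_eq_qFac_mul (q / z) hq1 (k + k)
  have s5 := qPochInf_eq_qFac_mul (q / z) hq1 k
  have s6 := qPochInf_eq_qFac_mul (z * q) hq1 k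
  have n1 := qFac_ne_zero hqq (k + k)
  have n2 := qFac_ne_zero hqq k
  have n3 := qFac_ne_zero hzz k
  have n4 := qFac_ne_zero hqz (k + k)
  have n5 := qFac_ne_zero hqz k
  have n6 := qFac_ne_zero hzq k
  have m1 := qPochInf_ne_zero hq1 hqz
  have m2 := qPochInf_ne_zero hq1 hzq
  -- Each infinite product with a shifted argument becomes `(y; q)_∞ / (y; q)_j`, so the
  -- `k`-dependence is left in finite factorials only.
  rw [← div_eq_iff_mul_eq n1 |>.mpr ((mul_comm _ _).trans s1.symm),
    ← div_eq_iff_mul_eq n2 |>.mpr ((mul_comm _ _).trans s2.symm),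
    ← div_eq_iff_mul_eq n3 |>.mpr ((mul_comm _ _).trans s3.symm),
    ← div_eq_iff_mul_eq n4 |>.mpr ((mul_comm _ _).trans s4.symm),
    ← div_eq_iff_mul_eq n5 |>.mpr ((mul_comm _ _).trans s5.symm),
    ← div_eq_iff_mul_eq n6 |>.mpr ((mul_comm _ _).trans s6.symm), eightTerm]
  have n7 := qFac_ne_zero hc k
  have n8 := qFac_ne_zero hd k
  have n9 := qFac_ne_zero he k
  clear s1 s2 s3 s4 s5 s6 hsix
  field_simp

include hq1 hc0 hd0 he0 hz0 hq0 hz hqz1 hc hd he hzq hzz in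
/-- The transformation of a very-well-poised `₈φ₇` with `a → 1`. -/
theorem hasSum_foldTerm :
    HasSum (foldTerm c d e z q) (qPochInf q q ^ 3 * qPochInf (q / z ^ 2) q /
      (qPochInf (z * q) q * qPochInf (q / z) q ^ 3) * ∑' k, eightTerm c d e z q k) := by
  have hs := summable_doubleTerm hq1 hz0 hqz1 hc hd he hzq
  rw [← tsum_mul_left]
  simp only [← tsum_doubleTerm_row hq1 hz0 hq0 hqz1 hc hd he hzq hzz]
  rw [← hs.tsum_prod]
  -- The same summable family regrouped by antidiagonals.
  have h := (Finset.HasAntidiagonal.sigmaAntidiagonalEquivProd (A := ℕ)).hasSum_iff.mpr hs.hasSum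
  have h2 := h.sigma (fun n => hasSum_fintype _)
  refine h2.congr_fun fun n => ?_
  rw [← sum_antidiagonal_doubleTerm hq1 hc0 hd0 he0 hz0 hq0 hz hqz1 hc hd he n,
    ← Finset.sum_coe_sort]
  rfl

include hq1 hc hd he hzz in
theorem summable_eightTerm : Summable (eightTerm c d e z q) := by
  have hqq := mul_pow_ne_one_of_norm_lt_one hq1 hq1
  obtain ⟨A1, p1, h1⟩ := exists_norm_vwpFac_le hq1 ‖1 / z‖
  obtain ⟨A2, p2, h2⟩ := exists_norm_qFac_le hq1 ‖c / z‖
  obtain ⟨A3, p3, h3⟩ := exists_norm_qFac_le hq1 ‖d / z‖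
  obtain ⟨A4, p4, h4⟩ := exists_norm_qFac_le hq1 ‖e / z‖
  obtain ⟨A5, p5, h5⟩ := exists_norm_qFac_le hq1 ‖1 / z‖
  obtain ⟨A6, p6, h6⟩ := exists_norm_qFac_le hq1 ‖z‖
  obtain ⟨B1, r1, i1⟩ := exists_norm_inv_qFac_le hq1 hqq
  obtain ⟨B2, r2, i2⟩ := exists_norm_inv_qFac_le hq1 hc
  obtain ⟨B3, r3, i3⟩ := exists_norm_inv_qFac_le hq1 hd
  obtain ⟨B4, r4, i4⟩ := exists_norm_inv_qFac_le hq1 he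
  obtain ⟨B5, r5, i5⟩ := exists_norm_inv_qFac_le hq1 hzz
  refine Summable.of_norm_bounded ((summable_geometric_of_lt_one (norm_nonneg _) hq1).mul_left
    (A1 * (A2 * A3 * A4 * A5 * A6) * (B1 * (B2 * B3 * B4 * B1 * B5)))) fun k => ?_
  rw [eightTerm, div_eq_mul_inv]
  simp only [mul_inv, norm_mul, norm_pow]
  have w1 := h1 _ le_rfl k
  have w2 := h2 _ le_rfl k
  have w3 := h3 _ le_rfl k
  have w4 := h4 _ le_rfl k
  have w5 := h5 _ le_rfl k
  have w6 := h6 _ le_rfl k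
  have v1 := i1 k
  have v2 := i2 k
  have v3 := i3 k
  have v4 := i4 k
  have v5 := i5 k
  gcongr

end

/-! ### The bilateral terms at nonnegative and negative indices. -/

/-- `∏_{k=1}^{n} (1 - x q ^ (-k))`, the reciprocal of `(x; q)_{-n}`. -/
def qFacNeg (x q : ℂ) (n : ℕ) : ℂ := ∏ k ∈ Finset.range n, (1 - x * (q ^ (k + 1))⁻¹)

theorem qPoch_natCast (x q : ℂ) (n : ℕ) : qPoch x q (n : ℤ) = qFac x q n := rfl

theorem qPoch_neg (x q : ℂ) (n : ℕ) : qPoch x q (-((n : ℤ) + 1)) = (qFacNeg x q (n + 1))⁻¹ := by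
  rw [← Int.negSucc_eq]; rfl

theorem qFacNeg_ne_zero {x q : ℂ} (hq0 : q ≠ 0) (h : ∀ k : ℕ, x ≠ q ^ (k + 1)) (n : ℕ) :
    qFacNeg x q n ≠ 0 := by
  refine Finset.prod_ne_zero_iff.mpr fun k _ => sub_ne_zero.mpr fun h1 => h k ?_
  have := pow_ne_zero (k + 1) hq0
  field_simp at h1
  exact h1.symm

/-- The factors of a well-poised bilateral series at negative indices. -/
theorem qFacNeg_div_qFacNeg {a y q : ℂ} (hq0 : q ≠ 0) (ha : a ≠ 0) (hy : y ≠ 0) (n : ℕ) :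
    qFacNeg (a * q / y) q n / qFacNeg y q n =
      (a * q / y ^ 2) ^ n * (qFac (y / a) q n / qFac (q / y) q n) := by
  induction n with
  | zero => simp [qFacNeg]
  | succ n ih =>
    rw [qFac_succ, qFac_succ, qFacNeg, qFacNeg, Finset.prod_range_succ, Finset.prod_range_succ,
      ← qFacNeg, ← qFacNeg, mul_div_mul_comm, ih]
    have hn := pow_ne_zero n hq0
    have e1 : 1 - a * q / y * (q ^ (n + 1))⁻¹ =
        a / y * (q ^ n)⁻¹ * (-(1 - y / a * q ^ n)) := by
      rw [pow_succ]; field_simp; ring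
    have e2 : 1 - y * (q ^ (n + 1))⁻¹ =
        y / (q * q ^ n) * (-(1 - q / y * q ^ n)) := by
      rw [pow_succ]; field_simp; ring
    have e3 : a / y * (q ^ n)⁻¹ / (y / (q * q ^ n)) = a * q / y ^ 2 := by field_simp
    rw [e1, e2, mul_div_mul_comm _ _ (y / _), neg_div_neg_eq, e3, pow_succ,
      mul_div_mul_comm (qFac (y / a) q n) _ (qFac (q / y) q n)]
    ring

theorem qFacNeg_shift {s q : ℂ} (hq0 : q ≠ 0) (n : ℕ) :
    qFacNeg (s * q) q n * (1 - s * (q ^ n)⁻¹) = (1 - s) * qFacNeg s q n := by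
  induction n with
  | zero => simp [qFacNeg]
  | succ n ih =>
    rw [qFacNeg, qFacNeg, Finset.prod_range_succ, Finset.prod_range_succ, ← qFacNeg, ← qFacNeg]
    have : s * q * (q ^ (n + 1))⁻¹ = s * (q ^ n)⁻¹ := by
      have hn := pow_ne_zero n hq0
      rw [pow_succ]; field_simp
    rw [this, ih]
    ring

theorem qFac_shift (s q : ℂ) (n : ℕ) :
    (1 - s) * qFac (s * q) q n = qFac s q n * (1 - s * q ^ n) := by
  rw [← qFac_succ', qFac_succ]

/-- The terms with nonnegative index of the bilateral series, with `a = s ^ 2`. -/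
def bilatPos (c d e z q s : ℂ) (n : ℕ) : ℂ :=
  (1 + s * q ^ n) / (1 + s) *
    (qFac c q n * qFac d q n * qFac e q n * qFac (1 / z) q n * qFac z q n) /
    (qFac (s ^ 2 * q / c) q n * qFac (s ^ 2 * q / d) q n * qFac (s ^ 2 * q / e) q n *
      qFac (s ^ 2 * q / (1 / z)) q n * qFac (s ^ 2 * q / z) q n) * (q / z) ^ n

/-- The terms with negative index of the bilateral series, with `a = s ^ 2`. -/
def bilatNeg (c d e z q s : ℂ) (n : ℕ) : ℂ :=
  (q ^ n + s) / (1 + s) *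
    (qFac (c / s ^ 2) q n * qFac (d / s ^ 2) q n * qFac (e / s ^ 2) q n *
      qFac (1 / z / s ^ 2) q n * qFac (z / s ^ 2) q n) /
    (qFac (q / c) q n * qFac (q / d) q n * qFac (q / e) q n *
      qFac (q / (1 / z)) q n * qFac (q / z) q n) * (s ^ 10 * (q / z)) ^ n

section
variable {c d e z q a s : ℂ} (hq1 : ‖q‖ < 1) (hq0 : q ≠ 0) (ha : Complex.sqrt a = s)
  (has : a = s ^ 2) (hs1 : s ≠ 1) (hs2 : ‖s * q‖ < 1) (hs3 : ‖q‖ < ‖s‖) (hs4 : 1 + s ≠ 0)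
  (hs0 : s ≠ 0)
include hq1 hq0 ha has hs1 hs2 hs3 hs4 hs0

omit hs3 in
-- The parameter `√a = s` cancels the lower `s`, and its partner `aq/s = sq` cancels the upper
-- `q√a`; the remaining pair `-sq`, `-s` gives `(1 + sq^n)/(1 + s)`. The cancellation needs `s ≠ 1`,
-- as `(1; q)_n = 0` for `n ≥ 1`.
theorem vwpPsiTerm_natCast (n : ℕ) :
    vwpPsiTerm a [Complex.sqrt a, c, d, e, 1 / z, z] q (q / z) n = bilatPos c d e z q s n := by
  have k1 : ∀ k : ℕ, s * q * q ^ k ≠ 1 := mul_pow_ne_one_of_norm_lt_one hq1 hs2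
  have k2 : ∀ k : ℕ, -s * q * q ^ k ≠ 1 := mul_pow_ne_one_of_norm_lt_one hq1 (by simpa using hs2)
  have e1 := qFac_shift s q n
  have e2 := qFac_shift (-s) q n
  have n1 := qFac_ne_zero k1 n
  have n2 := qFac_ne_zero k2 n
  have s1 : 1 - s ≠ 0 := sub_ne_zero.mpr hs1.symm
  have s2 : 1 - -s ≠ 0 := by rwa [sub_neg_eq_add]
  have m1 : qFac s q n ≠ 0 := left_ne_zero_of_mul (e1 ▸ mul_ne_zero s1 n1)
  have m2 : qFac (-s) q n ≠ 0 := left_ne_zero_of_mul (e2 ▸ mul_ne_zero s2 n2)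
  have h0 : s ^ 2 * q / s = s * q := by field_simp
  have h1 : -(q * s) = -s * q := by ring
  simp only [vwpPsiTerm, psiTerm, qPochList, List.map_cons, List.map_nil, List.prod_cons,
    List.prod_nil, qPoch_natCast, ha, zpow_natCast, mul_one]
  rw [has, h0, h1, mul_comm q s]
  have e3 : qFac (-s * q) q n = qFac (-s) q n * ((1 + s * q ^ n) / (1 + s)) := by
    rw [mul_div_assoc', eq_div_iff hs4]
    linear_combination e2
  rw [e3]
  trans ((qFac (s * q) q n / qFac (s * q) q n) * (qFac s q n / qFac s q n) *
    (qFac (-s) q n / qFac (-s) q n)) * bilatPos c d e z q s n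
  · simp only [bilatPos, div_eq_mul_inv _ (qFac _ _ _), div_eq_mul_inv _ (_ * _), mul_inv]
    ring
  · rw [div_self n1, div_self m1, div_self m2, one_mul, one_mul, one_mul]

variable (hc0 : c ≠ 0) (hd0 : d ≠ 0) (he0 : e ≠ 0) (hz0 : z ≠ 0) (hz : c * d * e = z * q)
include hc0 hd0 he0 hz0 hz

omit hs2 in
theorem vwpPsiTerm_neg (n : ℕ) :
    vwpPsiTerm a [Complex.sqrt a, c, d, e, 1 / z, z] q (q / z) (-((n : ℤ) + 1)) =
      bilatNeg c d e z q s (n + 1) := by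
  -- This keeps `s` and `-s` off the positive powers of `q`, the zeros of the reciprocal factorials
  -- at negative index.
  have hs5 : ∀ k : ℕ, ‖q ^ (k + 1)‖ < ‖s‖ := fun k => by
    rw [norm_pow, pow_succ]
    refine lt_of_le_of_lt ?_ hs3
    exact mul_le_of_le_one_left (norm_nonneg _) (pow_le_one₀ (norm_nonneg _) hq1.le)
  have k1 : ∀ k : ℕ, s ≠ q ^ (k + 1) := fun k h => (hs5 k).ne (by rw [h])
  have k2 : ∀ k : ℕ, -s ≠ q ^ (k + 1) := fun k h => (hs5 k).ne (by rw [← h, norm_neg])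
  have n1 := qFacNeg_ne_zero hq0 k1 (n + 1)
  have n2 := qFacNeg_ne_zero hq0 k2 (n + 1)
  have e1 := qFacNeg_shift (s := s) hq0 (n + 1)
  have e2 := qFacNeg_shift (s := -s) hq0 (n + 1)
  have s1 : 1 - s ≠ 0 := sub_ne_zero.mpr hs1.symm
  have s2 : 1 - -s ≠ 0 := by rwa [sub_neg_eq_add]
  have m1 : qFacNeg (s * q) q (n + 1) ≠ 0 := left_ne_zero_of_mul (e1 ▸ mul_ne_zero s1 n1)
  have m2 : qFacNeg (-s * q) q (n + 1) ≠ 0 := left_ne_zero_of_mul (e2 ▸ mul_ne_zero s2 n2)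
  have h0 : s ^ 2 * q / s = s * q := by field_simp
  have h1 : -(q * s) = -s * q := by ring
  have hz1 : (1 / z : ℂ) ≠ 0 := one_div_ne_zero hz0
  have hss : s ^ 2 ≠ 0 := pow_ne_zero 2 hs0
  have hzp : (q / z) ^ (-((n : ℤ) + 1)) = ((q / z) ^ (n + 1))⁻¹ := by
    rw [zpow_neg]; norm_cast
  simp only [vwpPsiTerm, psiTerm, qPochList, List.map_cons, List.map_nil, List.prod_cons,
    List.prod_nil, qPoch_neg, ha, bilatNeg, mul_one]
  rw [has, h0, h1, mul_comm q s, hzp]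
  have f1 := qFacNeg_div_qFacNeg hq0 hss hc0 (n + 1)
  have f2 := qFacNeg_div_qFacNeg hq0 hss hd0 (n + 1)
  have f3 := qFacNeg_div_qFacNeg hq0 hss he0 (n + 1)
  have f4 := qFacNeg_div_qFacNeg hq0 hss hz1 (n + 1)
  have f5 := qFacNeg_div_qFacNeg hq0 hss hz0 (n + 1)
  have hqn : q ^ (n + 1) ≠ 0 := pow_ne_zero _ hq0
  have f6 : qFacNeg (-s) q (n + 1) / qFacNeg (-s * q) q (n + 1) =
      (q ^ (n + 1))⁻¹ * ((q ^ (n + 1) + s) / (1 + s)) := by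
    rw [div_eq_iff m2]
    field_simp at e2 ⊢
    linear_combination -e2
  -- Each of the five reflected parameters contributes `s ^ 2`, whence `s ^ 10`; `cde = zq` reduces
  -- the rest to `q / z`.
  have hpow : (q ^ (n + 1))⁻¹ * ((s ^ 2 * q / c ^ 2) ^ (n + 1) * (s ^ 2 * q / d ^ 2) ^ (n + 1) *
      (s ^ 2 * q / e ^ 2) ^ (n + 1) * (s ^ 2 * q / (1 / z) ^ 2) ^ (n + 1) *
      (s ^ 2 * q / z ^ 2) ^ (n + 1)) * ((q / z) ^ (n + 1))⁻¹ = (s ^ 10 * (q / z)) ^ (n + 1) := by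
    rw [← inv_pow, ← inv_pow]
    simp only [← mul_pow]
    congr 1
    have hcde : c ^ 2 * d ^ 2 * e ^ 2 = z ^ 2 * q ^ 2 := by
      rw [← mul_pow, ← mul_pow, hz, mul_pow]
    field_simp
    linear_combination (-1 : ℂ) * hcde
  rw [← hpow]
  calc _ = (qFacNeg (-s) q (n + 1) / qFacNeg (-s * q) q (n + 1)) *
        (qFacNeg (s ^ 2 * q / c) q (n + 1) / qFacNeg c q (n + 1)) *
        (qFacNeg (s ^ 2 * q / d) q (n + 1) / qFacNeg d q (n + 1)) *
        (qFacNeg (s ^ 2 * q / e) q (n + 1) / qFacNeg e q (n + 1)) *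
        (qFacNeg (s ^ 2 * q / (1 / z)) q (n + 1) / qFacNeg (1 / z) q (n + 1)) *
        (qFacNeg (s ^ 2 * q / z) q (n + 1) / qFacNeg z q (n + 1)) *
        ((q / z) ^ (n + 1))⁻¹ * ((qFacNeg (s * q) q (n + 1) / qFacNeg (s * q) q (n + 1)) *
          (qFacNeg s q (n + 1) / qFacNeg s q (n + 1))) := by
        simp only [div_eq_mul_inv _ (qFacNeg _ _ _), div_eq_mul_inv _ (_ * _), mul_inv, inv_inv]
        ring
    _ = _ := by
        rw [f1, f2, f3, f4, f5, f6, div_self m1, div_self n1]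
        simp only [div_eq_mul_inv _ (qFac _ _ _), div_eq_mul_inv _ (_ * _), mul_inv]
        ring

end

/-! ### Domination and the limit of the bilateral series as `a → 1`. -/

section
variable {c d e z q : ℂ} (hq1 : ‖q‖ < 1) (hc0 : c ≠ 0) (hd0 : d ≠ 0) (he0 : e ≠ 0) (hz0 : z ≠ 0)
  (hq0 : q ≠ 0) (hz : c * d * e = z * q) (hqz1 : ‖q / z‖ < 1)
  (hc : ∀ k : ℕ, q / c * q ^ k ≠ 1) (hd : ∀ k : ℕ, q / d * q ^ k ≠ 1)
  (he : ∀ k : ℕ, q / e * q ^ k ≠ 1) (hzq : ∀ k : ℕ, q / (1 / z) * q ^ k ≠ 1)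

theorem eventually_norm_inv_qFac_sq_mul_le {y : ℂ} (hq1 : ‖q‖ < 1)
    (hy : ∀ k : ℕ, q / y * q ^ k ≠ 1) :
    ∃ C : ℝ, 1 ≤ C ∧ ∀ᶠ s in 𝓝 (1 : ℂ), ∀ n : ℕ, ‖(qFac (s ^ 2 * q / y) q n)⁻¹‖ ≤ C := by
  obtain ⟨C, h1, h2⟩ := eventually_norm_inv_qFac_le hq1 hy
  have ht : Tendsto (fun s : ℂ => s ^ 2 * q / y) (𝓝 1) (𝓝 (q / y)) := by
    have : Continuous fun s : ℂ => s ^ 2 * q / y := by fun_prop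
    simpa using this.tendsto 1
  exact ⟨C, h1, (ht.eventually h2).mono fun s hs n => (hs n).2⟩

theorem eventually_norm_qFac_div_sq_le (hq1 : ‖q‖ < 1) (y : ℂ) :
    ∃ C : ℝ, 1 ≤ C ∧ ∀ᶠ s in 𝓝 (1 : ℂ), ∀ n : ℕ, ‖qFac (y / s ^ 2) q n‖ ≤ C := by
  obtain ⟨C, h1, h2⟩ := exists_norm_qFac_le hq1 (‖y‖ + 1)
  have ht : ContinuousAt (fun s : ℂ => ‖y / s ^ 2‖) 1 := by
    have : (1 : ℂ) ^ 2 ≠ 0 := by norm_num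
    fun_prop (disch := assumption)
  have h3 := ht.tendsto.eventually_lt_const (u := ‖y‖ + 1) (by simp)
  exact ⟨C, h1, h3.mono fun s hs n => h2 _ hs.le n⟩

theorem eventually_norm_inv_one_add_le : ∀ᶠ s in 𝓝 (1 : ℂ), ‖(1 + s)⁻¹‖ ≤ 1 := by
  have : ContinuousAt (fun s : ℂ => ‖(1 + s)⁻¹‖) 1 := by
    have : (1 : ℂ) + 1 ≠ 0 := by norm_num
    fun_prop (disch := assumption)
  refine (this.tendsto.eventually_lt_const (u := 1) ?_).mono fun s hs => hs.le
  norm_num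

theorem eventually_norm_le_two : ∀ᶠ s in 𝓝 (1 : ℂ), ‖s‖ ≤ 2 :=
  (continuous_norm.continuousAt.tendsto.eventually_lt_const (u := 2) (by simp)).mono
    fun _ hs => hs.le

include hq1 hqz1 hc hd he hzq in
theorem eventually_norm_bilatPos_le : ∃ C : ℝ, ∀ᶠ s in 𝓝 (1 : ℂ), ∀ n : ℕ,
    ‖bilatPos c d e z q s n‖ ≤ C * ‖q / z‖ ^ n := by
  obtain ⟨A1, p1, h1⟩ := exists_norm_qFac_le hq1 ‖c‖
  obtain ⟨A2, p2, h2⟩ := exists_norm_qFac_le hq1 ‖d‖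
  obtain ⟨A3, p3, h3⟩ := exists_norm_qFac_le hq1 ‖e‖
  obtain ⟨A4, p4, h4⟩ := exists_norm_qFac_le hq1 ‖1 / z‖
  obtain ⟨A5, p5, h5⟩ := exists_norm_qFac_le hq1 ‖z‖
  obtain ⟨B1, r1, i1⟩ := eventually_norm_inv_qFac_sq_mul_le hq1 hc
  obtain ⟨B2, r2, i2⟩ := eventually_norm_inv_qFac_sq_mul_le hq1 hd
  obtain ⟨B3, r3, i3⟩ := eventually_norm_inv_qFac_sq_mul_le hq1 he
  obtain ⟨B4, r4, i4⟩ := eventually_norm_inv_qFac_sq_mul_le hq1 hzq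
  obtain ⟨B5, r5, i5⟩ := eventually_norm_inv_qFac_sq_mul_le hq1
    (mul_pow_ne_one_of_norm_lt_one hq1 hqz1)
  refine ⟨3 * 1 * (A1 * A2 * A3 * A4 * A5) * (B1 * B2 * B3 * B4 * B5), ?_⟩
  filter_upwards [i1, i2, i3, i4, i5, eventually_norm_inv_one_add_le, eventually_norm_le_two]
    with s j1 j2 j3 j4 j5 j6 j7 n
  have hw : ‖1 + s * q ^ n‖ ≤ 3 := by
    refine (norm_add_le _ _).trans ?_
    rw [norm_one, norm_mul, norm_pow]
    nlinarith [pow_le_one₀ (n := n) (norm_nonneg q) hq1.le, norm_nonneg s]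
  rw [bilatPos, div_eq_mul_inv _ (_ * _), div_eq_mul_inv _ (1 + s)]
  simp only [mul_inv, norm_mul, norm_pow]
  have w1 := h1 _ le_rfl n
  have w2 := h2 _ le_rfl n
  have w3 := h3 _ le_rfl n
  have w4 := h4 _ le_rfl n
  have w5 := h5 _ le_rfl n
  have v1 := j1 n
  have v2 := j2 n
  have v3 := j3 n
  have v4 := j4 n
  have v5 := j5 n
  gcongr

include hq1 hqz1 hc hd he hzq in
theorem eventually_norm_bilatNeg_le : ∃ C r : ℝ, 0 ≤ r ∧ r < 1 ∧ ∀ᶠ s in 𝓝 (1 : ℂ), ∀ n : ℕ,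
    ‖bilatNeg c d e z q s n‖ ≤ C * r ^ n := by
  -- The ratio `s ^ 10 * (q / z)` varies with `s`, so a rate strictly above `‖q / z‖` is needed for
  -- a bound uniform near `s = 1`.
  obtain ⟨r, hr0, hr1⟩ := exists_between hqz1
  obtain ⟨A1, p1, h1⟩ := eventually_norm_qFac_div_sq_le hq1 c
  obtain ⟨A2, p2, h2⟩ := eventually_norm_qFac_div_sq_le hq1 d
  obtain ⟨A3, p3, h3⟩ := eventually_norm_qFac_div_sq_le hq1 e
  obtain ⟨A4, p4, h4⟩ := eventually_norm_qFac_div_sq_le hq1 (1 / z)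
  obtain ⟨A5, p5, h5⟩ := eventually_norm_qFac_div_sq_le hq1 z
  obtain ⟨B1, r1, i1⟩ := exists_norm_inv_qFac_le hq1 hc
  obtain ⟨B2, r2, i2⟩ := exists_norm_inv_qFac_le hq1 hd
  obtain ⟨B3, r3, i3⟩ := exists_norm_inv_qFac_le hq1 he
  obtain ⟨B4, r4, i4⟩ := exists_norm_inv_qFac_le hq1 hzq
  obtain ⟨B5, r5, i5⟩ := exists_norm_inv_qFac_le hq1 (mul_pow_ne_one_of_norm_lt_one hq1 hqz1)
  have hx : ∀ᶠ s in 𝓝 (1 : ℂ), ‖s ^ 10 * (q / z)‖ < r := by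
    have : Continuous fun s : ℂ => ‖s ^ 10 * (q / z)‖ := by fun_prop
    exact this.continuousAt.eventually (gt_mem_nhds (by simpa using hr0))
  refine ⟨3 * 1 * (A1 * A2 * A3 * A4 * A5) * (B1 * B2 * B3 * B4 * B5), r,
    (norm_nonneg _).trans hr0.le, hr1, ?_⟩
  filter_upwards [h1, h2, h3, h4, h5, eventually_norm_inv_one_add_le, eventually_norm_le_two, hx]
    with s j1 j2 j3 j4 j5 j6 j7 j8 n
  have hw : ‖q ^ n + s‖ ≤ 3 := by
    refine (norm_add_le _ _).trans ?_
    rw [norm_pow]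
    linarith [pow_le_one₀ (n := n) (norm_nonneg q) hq1.le]
  rw [bilatNeg, div_eq_mul_inv _ (_ * _), div_eq_mul_inv _ (1 + s)]
  simp only [mul_inv, norm_mul _ (_ ^ n), norm_pow (_ * _), norm_mul _ (1 + s)⁻¹,
    norm_mul _ (_ * _), norm_mul _ (qFac _ _ _), norm_mul _ (qFac _ _ _)⁻¹]
  have w1 := i1 n
  have w2 := i2 n
  have w3 := i3 n
  have w4 := i4 n
  have w5 := i5 n
  have v1 := j1 n
  have v2 := j2 n
  have v3 := j3 n
  have v4 := j4 n
  have v5 := j5 n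
  gcongr

include hq1 hqz1 hc hd he hzq in
theorem tendsto_bilatPos (n : ℕ) :
    Tendsto (fun s => bilatPos c d e z q s n) (𝓝 1) (𝓝 (bilatPos c d e z q 1 n)) := by
  have k := fun y => continuous_qFac q n |>.comp (f := fun s : ℂ => s ^ 2 * q / y) (by fun_prop)
  have n1 : ∀ y, (∀ k : ℕ, q / y * q ^ k ≠ 1) → qFac ((1 : ℂ) ^ 2 * q / y) q n ≠ 0 :=
    fun y hy => by simpa using qFac_ne_zero hy n
  have m1 := n1 _ hc
  have m2 := n1 _ hd
  have m3 := n1 _ he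
  have m4 := n1 _ hzq
  have m5 := n1 _ (mul_pow_ne_one_of_norm_lt_one hq1 hqz1)
  unfold bilatPos
  have h0 : ContinuousAt (fun s : ℂ => (1 + s * q ^ n) / (1 + s)) 1 := by
    have : (1 : ℂ) + 1 ≠ 0 := by norm_num
    fun_prop (disch := assumption)
  exact ((h0.mul continuousAt_const).div (((((k c).mul (k d)).mul (k e)).mul
    (k (1 / z))).mul (k z)).continuousAt (mul_ne_zero (mul_ne_zero (mul_ne_zero
    (mul_ne_zero m1 m2) m3) m4) m5)).mul continuousAt_const

theorem tendsto_bilatNeg (n : ℕ) :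
    Tendsto (fun s => bilatNeg c d e z q s n) (𝓝 1) (𝓝 (bilatNeg c d e z q 1 n)) := by
  have k : ∀ y, ContinuousAt (fun s : ℂ => qFac (y / s ^ 2) q n) 1 := fun y => by
    have : (1 : ℂ) ^ 2 ≠ 0 := by norm_num
    have h : ContinuousAt (fun s : ℂ => y / s ^ 2) 1 := by fun_prop (disch := assumption)
    exact (continuous_qFac q n).continuousAt.comp h
  unfold bilatNeg
  have h0 : ContinuousAt (fun s : ℂ => (q ^ n + s) / (1 + s)) 1 := by
    have : (1 : ℂ) + 1 ≠ 0 := by norm_num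
    fun_prop (disch := assumption)
  have h1 : ContinuousAt (fun s : ℂ => (s ^ 10 * (q / z)) ^ n) 1 := by fun_prop
  exact ((h0.mul (((((k c).mul (k d)).mul (k e)).mul (k (1 / z))).mul (k z))).div_const _).mul h1

theorem bilatPos_one_zero : bilatPos c d e z q 1 0 = 1 := by
  simp [bilatPos]

/-- At `s = 1` the indices `n + 1` and `-(n + 1)` each carry half of the weight `1 + q ^ (n + 1)`;
index `0` occurs once, with weight `1`. -/
theorem bilatPos_one_succ (n : ℕ) :
    bilatPos c d e z q 1 (n + 1) = foldTerm c d e z q (n + 1) / 2 := by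
  simp only [bilatPos, foldTerm, foldWeight, if_neg (Nat.succ_ne_zero n), one_mul, one_pow,
    div_div_eq_mul_div, div_one]
  rw [mul_comm q z]
  ring

theorem bilatNeg_one_succ (n : ℕ) :
    bilatNeg c d e z q 1 (n + 1) = foldTerm c d e z q (n + 1) / 2 := by
  simp only [bilatNeg, foldTerm, foldWeight, if_neg (Nat.succ_ne_zero n), one_mul, one_pow,
    div_one]
  rw [show q / (1 / z) = z * q by rw [div_div_eq_mul_div, div_one, mul_comm]]
  ring

/-- The limit of the bilateral series is the folded unilateral series. -/
theorem bilat_one_eq {S : ℂ} (h : HasSum (foldTerm c d e z q) S) :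
    ∑' n, bilatPos c d e z q 1 n + ∑' n, bilatNeg c d e z q 1 (n + 1) = S := by
  have hs : Summable fun n => foldTerm c d e z q (n + 1) := (summable_nat_add_iff 1).mpr h.summable
  have hp : Summable (bilatPos c d e z q 1) := by
    rw [← summable_nat_add_iff 1]
    simpa only [bilatPos_one_succ] using hs.div_const 2
  rw [hp.tsum_eq_zero_add, ← h.tsum_eq, h.summable.tsum_eq_zero_add]
  simp only [bilatPos_one_succ, bilatNeg_one_succ, bilatPos_one_zero, tsum_div_const]
  have : foldTerm c d e z q 0 = 1 := by simp [foldTerm, foldWeight]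
  rw [this]
  ring

include hq1 hc0 hd0 he0 hz0 hq0 hz hqz1 hc hd he hzq in
/-- The bilateral series converges for `a` near `1`, and its sum tends to the folded series. -/
theorem vwpPsi_summable_and_tendsto {S : ℂ} (h : HasSum (foldTerm c d e z q) S) :
    (∀ᶠ a in 𝓝[≠] (1 : ℂ),
      Summable (vwpPsiTerm a [Complex.sqrt a, c, d, e, 1 / z, z] q (q / z))) ∧
    Tendsto (fun a : ℂ => vwpPsi a [Complex.sqrt a, c, d, e, 1 / z, z] q (q / z))
        (𝓝[≠] 1) (𝓝 S) := by
  -- The principal root is continuous at `1`, so all estimates may be made in `s = √a` near `1`.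
  have hsq : Tendsto Complex.sqrt (𝓝[≠] 1) (𝓝 1) := by
    have : ContinuousAt Complex.sqrt 1 := Complex.continuousAt_sqrt (by simp)
    simpa using this.tendsto.mono_left nhdsWithin_le_nhds
  obtain ⟨C, hC⟩ := eventually_norm_bilatPos_le hq1 hqz1 hc hd he hzq
  obtain ⟨D, r, hr0, hr1, hD⟩ := eventually_norm_bilatNeg_le hq1 hqz1 hc hd he hzq
  have hCs : Summable fun n : ℕ => C * ‖q / z‖ ^ n :=
    (summable_geometric_of_lt_one (norm_nonneg _) hqz1).mul_left C
  have hDs : Summable fun n : ℕ => D * r ^ (n + 1) :=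
    ((summable_nat_add_iff 1).mpr (summable_geometric_of_lt_one hr0 hr1)).mul_left D
  have e2 : ∀ᶠ s in 𝓝 (1 : ℂ), ‖s * q‖ < 1 := by
    have : Continuous fun s : ℂ => ‖s * q‖ := by fun_prop
    exact this.continuousAt.eventually (gt_mem_nhds (by simpa using hq1))
  have e3 : ∀ᶠ s in 𝓝 (1 : ℂ), ‖q‖ < ‖s‖ :=
    continuous_norm.continuousAt.eventually (lt_mem_nhds (by simpa using hq1))
  have e4 : ∀ᶠ s in 𝓝 (1 : ℂ), 1 + s ≠ 0 := by
    have : Continuous fun s : ℂ => 1 + s := by fun_prop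
    exact this.continuousAt.eventually_ne (by norm_num)
  have hev : ∀ᶠ a in 𝓝[≠] (1 : ℂ), HasSum
      (vwpPsiTerm a [Complex.sqrt a, c, d, e, 1 / z, z] q (q / z))
      (∑' n, bilatPos c d e z q (Complex.sqrt a) n +
        ∑' n, bilatNeg c d e z q (Complex.sqrt a) (n + 1)) := by
    filter_upwards [self_mem_nhdsWithin, hsq.eventually hC, hsq.eventually hD, hsq.eventually e2,
      hsq.eventually e3, hsq.eventually e4] with a ha1 c1 c2 c3 c4 c5
    have has : a = Complex.sqrt a ^ 2 := by simp [Complex.sqrt]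
    have hs1 : Complex.sqrt a ≠ 1 := fun h => ha1 (by rw [has, h, one_pow]; rfl)
    have hs0 : Complex.sqrt a ≠ 0 := norm_pos_iff.mp ((norm_nonneg q).trans_lt c4)
    refine HasSum.of_nat_of_neg_add_one ?_ ?_
    · simp only [vwpPsiTerm_natCast hq1 hq0 rfl has hs1 c3 c5 hs0]
      exact (Summable.of_norm_bounded hCs c1).hasSum
    · simp only [vwpPsiTerm_neg hq1 hq0 rfl has hs1 c4 c5 hs0 hc0 hd0 he0 hz0 hz]
      exact (Summable.of_norm_bounded hDs fun n => c2 (n + 1)).hasSum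
  refine ⟨hev.mono fun a ha => ha.summable, ?_⟩
  rw [← bilat_one_eq h]
  have t1 := tendsto_tsum_of_dominated_convergence hCs
    (fun n => tendsto_bilatPos hq1 hqz1 hc hd he hzq n) hC
  have t2 := tendsto_tsum_of_dominated_convergence hDs
    (fun n => tendsto_bilatNeg (c := c) (d := d) (e := e) (z := z) (q := q) (n + 1))
    (hD.mono fun s hs n => hs (n + 1))
  exact ((t1.add t2).comp hsq).congr' (hev.mono fun a ha => ha.tsum_eq.symm)

/-! ### The terms of the `₈W₇` series and the conclusion. -/

include hq1 hz0 hq0 hqz1 in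
-- With `s = √(1/z)`, the pairs `±qs`, `±s` yield `(1 - q^(2n)/z)/(1 - 1/z)`, whose denominator
-- cancels the first factor of `(1/z; q)_n` when `n ≥ 1`.
theorem vwpWTerm_eq_eightTerm :
    vwpWTerm (1 / z) [c / z, d / z, e / z, 1 / z, z] q q = eightTerm c d e z q := by
  funext n
  have t1 : ∀ y : ℂ, 1 / z * q / (y / z) = q / y := fun y => by field_simp
  have t2 : 1 / z * q / z = q / z ^ 2 := by field_simp
  simp only [vwpWTerm, phiTerm, qPochList, List.map_cons, List.map_nil, List.prod_cons,
    List.prod_nil, qPoch_natCast, mul_one, eightTerm, t1, t2, div_one]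
  rcases n with _ | n
  · simp [vwpFac]
  -- For `z = 1` and positive index both sides vanish through `(1; q)_(n+1) = 0`, in accordance with
  -- the stated convention.
  by_cases hz1 : z = 1
  · subst hz1
    have : qFac (1 : ℂ) q (n + 1) = 0 := by rw [qFac_succ']; simp
    simp [this]
  set s := Complex.sqrt (1 / z) with hs
  have has : s ^ 2 = 1 / z := by simp [hs, Complex.sqrt]
  have hzn : ∀ k : ℕ, 1 / z * q ^ (2 * k) ≠ 1 := by
    intro k hk
    rcases k with _ | k
    · exact hz1 (by field_simp at hk; simpa using hk.symm)
    · refine mul_pow_ne_one_of_norm_lt_one hq1 hqz1 (2 * k + 1) ?_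
      rw [← hk]; ring
  have k1 : ∀ k : ℕ, s * q ^ k ≠ 1 := fun k hk => hzn k (by
    rw [← has]; linear_combination (s * q ^ k + 1) * hk)
  have k2 : ∀ k : ℕ, -s * q ^ k ≠ 1 := fun k hk => hzn k (by
    rw [← has]; linear_combination (-s * q ^ k + 1) * hk)
  have m1 := qFac_ne_zero k1 (n + 1)
  have m2 := qFac_ne_zero k2 (n + 1)
  have e1 := qFac_shift s q (n + 1)
  have e2 := qFac_shift (-s) q (n + 1)
  have hv : qFac (1 / z) q (n + 1) * qFac (q * s) q (n + 1) * qFac (-(q * s)) q (n + 1) =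
      vwpFac (1 / z) q (n + 1) * (qFac s q (n + 1) * qFac (-s) q (n + 1)) := by
    have h0 : 1 - 1 / z ≠ 0 := sub_ne_zero.mpr fun h => hzn 0 (by simpa using h.symm)
    refine mul_left_cancel₀ h0 ?_
    rw [vwpFac, qFac_succ' (1 / z), mul_comm q s, ← neg_mul]
    have h3 : (1 - s) * (1 - -s) = 1 - 1 / z := by rw [← has]; ring
    have h4 : (1 - s * q ^ (n + 1)) * (1 - -s * q ^ (n + 1)) =
        1 - 1 / z * q ^ (2 * (n + 1)) := by rw [← has]; ring
    rw [← h4]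
    nth_rewrite 1 [← h3]
    linear_combination (1 - 1 / z) * qFac (1 / z * q) q n * ((1 - -s) * qFac (-s * q) q (n + 1) *
      e1 + qFac s q (n + 1) * (1 - s * q ^ (n + 1)) * e2)
  rw [show ∀ A B D E F G H I : ℂ, A * (B * (D * (E * (F * (G * (H * I)))))) =
    A * B * D * (E * F * G * H * I) from fun _ _ _ _ _ _ _ _ => by ring, hv]
  trans ((qFac s q (n + 1) / qFac s q (n + 1)) * (qFac (-s) q (n + 1) / qFac (-s) q (n + 1))) *
    eightTerm c d e z q (n + 1)
  · simp only [eightTerm, div_eq_mul_inv _ (qFac _ _ _), div_eq_mul_inv _ (_ * _), mul_inv]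
    ring
  · rw [div_self m1, div_self m2, one_mul, one_mul, eightTerm]

end

theorem div_mul_pow_ne_one {y q : ℂ} (h : ∀ j : ℕ, y ≠ q ^ (j + 1)) (k : ℕ) :
    q / y * q ^ k ≠ 1 := by
  intro hk
  have hy : y ≠ 0 := by rintro rfl; simp at hk
  refine h k ?_
  field_simp at hk
  rw [pow_succ']
  exact hk.symm

end

theorem mainTheorem11 (q c d e z : ℂ) (hq0 : 0 < ‖q‖) (hq1 : ‖q‖ < 1)
    (hc0 : c ≠ 0) (hd0 : d ≠ 0) (he0 : e ≠ 0)
    (hz : z = c * d * e / q) (hqz : ‖q / z‖ < 1)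
    -- no denominator factor vanishes
    (hc : ∀ j : ℕ, c ≠ q ^ (j + 1)) (hd : ∀ j : ℕ, d ≠ q ^ (j + 1))
    (he : ∀ j : ℕ, e ≠ q ^ (j + 1)) (hzq : ∀ j : ℕ, 1 / z ≠ q ^ (j + 1))
    (hz2 : z ^ 2 ≠ q) :
    Summable (vwpWTerm (1 / z) [c / z, d / z, e / z, 1 / z, z] q q) ∧
    (∀ᶠ a in 𝓝[≠] (1 : ℂ),
      Summable (vwpPsiTerm a [Complex.sqrt a, c, d, e, 1 / z, z] q (q / z))) ∧
    ∃ L : ℂ,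
      Tendsto (fun a : ℂ => vwpPsi a [Complex.sqrt a, c, d, e, 1 / z, z] q (q / z))
        (𝓝[≠] 1) (𝓝 L) ∧
      vwpW (1 / z) [c / z, d / z, e / z, 1 / z, z] q q =
        qPochInf (z * q) q / qPochInf (q / z ^ 2) q *
          (qPochInf (q / z) q ^ 3 / qPochInf q q ^ 3) * L := by
  have hq : q ≠ 0 := norm_pos_iff.mp hq0
  have hz0 : z ≠ 0 := hz ▸ div_ne_zero (mul_ne_zero (mul_ne_zero hc0 hd0) he0) hq
  have hcde : c * d * e = z * q := by rw [hz]; field_simp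
  have kc := div_mul_pow_ne_one hc
  have kd := div_mul_pow_ne_one hd
  have ke := div_mul_pow_ne_one he
  have kz := div_mul_pow_ne_one hzq
  have kz' : ∀ k : ℕ, z * q * q ^ k ≠ 1 := fun k hk => kz k (by
    rw [div_div_eq_mul_div, div_one, mul_comm q z]; exact hk)
  -- Only `k = 0` uses `z ^ 2 ≠ q`; otherwise the product is `(q/z)^2` times a nonnegative power of
  -- `q`, of norm below `1`.
  have kzz : ∀ k : ℕ, q / z ^ 2 * q ^ k ≠ 1 := by
    intro k hk
    rcases k with _ | k
    · refine hz2 ?_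
      field_simp at hk
      simpa using hk.symm
    · have h1 : q / z * (q / z) * q ^ k = 1 := by rw [← hk]; field_simp; ring
      refine mul_pow_ne_one_of_norm_lt_one hq1 (x := q / z * (q / z)) ?_ k h1
      rw [norm_mul]
      nlinarith [norm_nonneg (q / z)]
  have hW := vwpWTerm_eq_eightTerm (c := c) (d := d) (e := e) hq1 hz0 hq hqz
  have hF := hasSum_foldTerm hq1 hc0 hd0 he0 hz0 hq hcde hqz kc kd ke kz' kzz
  obtain ⟨h1, h2⟩ := vwpPsi_summable_and_tendsto hq1 hc0 hd0 he0 hz0 hq hcde hqz kc kd ke kz hF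
  refine ⟨hW ▸ summable_eightTerm hq1 kc kd ke kzz, h1, _, h2, ?_⟩
  -- The constant relating the two series is nonzero, so the relation can be solved for the `₈W₇`
  -- sum.
  have n1 := qPochInf_ne_zero hq1 (mul_pow_ne_one_of_norm_lt_one hq1 hq1)
  have n2 := qPochInf_ne_zero hq1 (mul_pow_ne_one_of_norm_lt_one hq1 hqz)
  have n3 := qPochInf_ne_zero hq1 kz'
  have n4 := qPochInf_ne_zero hq1 kzz
  rw [vwpW, hW]
  field_simp
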